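/- Let $\mathcal Y\subset\mathbb R^{d_y}$ be nonempty, closed and convex, $\phi:\mathbb R^{d_x}\times\mathcal Y\to\mathbb R$, $F(x)=\max_{y\in\mathcal Y}\phi(x,y)$, and $y^*(x)=\operatorname{argmax}_{y\in\mathcal Y}\phi(x,y)$. For $\gamma>0$ let $F_\gamma(x)=\min_{x'}\{F(x')+\frac1{2\gamma}\|x'-x\|^2\}$, with $\operatorname{prox}_{\gamma F}(x)$ the minimizer. Let $\partial f(x)$ be the set of $v$ with $f(y)\ge f(x)+\langle v,y-x\rangle+o(\|y-x\|)$ as $y\to x$. Assume, with $\delta_\phi\ge 0$ and $\mu_\phi,L_{\phi,yx},M>0$: (i) for $y\in\mathcal Y$, $\phi(\cdot,y)$ is $\delta_\phi$-weakly convex, that is, $\phi(\cdot,y)+\frac{\delta_\phi}2\|\cdot\|^2$ is convex; for every $x$, $\phi(x,\cdot)$ is $\mu_\phi$-strongly concave on $\mathcal Y$; (ii) $\phi$ is differentiable in $y$ on $\mathcal Y$, and $\nabla_y\phi(\cdot,y)$ is $L_{\phi,yx}$-Lipschitz for every $y\in\mathcal Y$; (iii) $F_\gamma(x)\ge F_\gamma^*>-\infty$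 for all $x$; (iv) there is a stochastic oracle $\tilde\partial_x\phi(x,y;\xi),\ \tilde\nabla_y\phi(x,y;\xi)$ such that, for all $x\in\mathbb R^{d_x}$ and $y\in\mathcal Y$, its means are an element of $\partial_x\phi(x,y)$ and $\nabla_y\phi(x,y)$ respectively, and $\mathbb E\|\tilde\partial_x\phi(x,y;\xi)\|^2\le M^2$, $\mathbb E\|\tilde\nabla_y\phi(x,y;\xi)\|^2\le M^2$. Let $0<\gamma<1/\delta_\phi$ (any $\gamma>0$ if $\delta_\phi=0$), fix $\delta_\psi\ge0$, and for $\epsilon>0$ put $$\alpha=\min\Big\{\tfrac{1/\gamma-\delta_\phi}{2},\mu_\phi\Big\},\quad \tau=\min\Big\{\tfrac{\gamma^2\alpha^2}{4},\tfrac{\mu_\phi^{1.5}\gamma^2\alpha^{1.5}}{4L_{\phi,yx}}\Big\},\quad \nu=\min\Big\{1,\tfrac{2\tau}{\gamma^2\alpha}\Big\},\quad L_F=\tfrac{2}{\gamma-\gamma^2\min\{\delta_\psi,\delta_\phi\}},$$ $$\eta_1=\min\Big\{\tfrac{\gamma^2(1/\gamma-\delta_\phi)}{2},\ \tfrac1{2L_F\tau},\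 \tfrac{\min\{1,\gamma^2\}\min\{\alpha,\tau\}\nu\alpha}{384\,\tau M^2}\epsilon^2\Big\},\qquad \eta_0=\tau\eta_1 .$$ From deterministic $x_\phi^0,x_0\in\mathbb R^{d_x}$, $y_0\in\mathcal Y$, and i.i.d. samples $\xi_0,\xi_1,\dots$, run single-loop SMAG: $$x_\phi^{t+1}=x_\phi^t-\eta_1\big(\tilde\partial_x\phi(x_\phi^t,y_t;\xi_t)+\tfrac1\gamma(x_\phi^t-x_t)\big),\quad y_{t+1}=P_{\mathcal Y}\big(y_t+\eta_1\tilde\nabla_y\phi(x_\phi^t,y_t;\xi_t)\big),\quad x_{t+1}=x_t-\tfrac{\eta_0}{\gamma}(x_t-x_\phi^{t+1}).$$ Let $P_0=\frac{2\eta_0}{\eta_1\gamma^2\alpha}\big(\mathbb E\|x_\phi^1-\operatorname{prox}_{\gamma F}(x_0)\|^2+\mathbb E\|y_1-y^*(\operatorname{prox}_{\gamma F}(x_0))\|^2\big)$ and $$T_\epsilon=\frac{16(F_\gamma(x_0)-F_\gamma^*+P_0)}{\min\{1,\gamma^{-2}\}\min\{\alpha,\tau\}\nu\epsilon^2}\max\Big\{\tfrac{2}{\gamma^2(1/\gamma-\delta_\phi)},\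 2L_F\tau,\ \tfrac{384\,\tau M^2}{\min\{1,\gamma^2\}\min\{\alpha,\tau\}\nu\alpha\epsilon^2}\Big\}.$$ Then $F_\gamma$ is differentiable, and for every $\epsilon>0$ and every integer $T\ge\max\{1,T_\epsilon\}$ (all expectations being finite): $$\frac1T\sum_{t=0}^{T-1}\Big(\mathbb E\|x_\phi^{t+1}-\operatorname{prox}_{\gamma F}(x_t)\|^2+\mathbb E\|\nabla F_\gamma(x_t)\|^2\Big)\le\min\{1,\gamma^{-2}\}\frac{\epsilon^2}{4},$$ and, for $\bar t$ uniform on $\{0,\dots,T-1\}$ and independent of the samples, $x_{\bar t}$ is a nearly $\epsilon$-stationary point of $F$: there are random vectors $x',v$ with $v\in\partial F(x')$ almost surely, $\mathbb E\|v\|\le\epsilon$ and $\mathbb E\|x_{\bar t}-x'\|\le\epsilon$. Moreover $\eta_1=O(\epsilon^2)$ and $T_\epsilon=O(\epsilon^{-4})$: there is a constant $C$ independent of $\epsilon$ with $\eta_1\le C\epsilon^2$ and $T_\epsilon\le C\epsilon^{-4}$ for all $0<\epsilon\le1$. -/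

import Mathlib

open MeasureTheory ProbabilityTheory Topology
open scoped ENNReal

namespace SMAG

noncomputable section

/-- Euclidean space of dimension `d`. -/
abbrev Vec (d : ℕ) : Type := EuclideanSpace ℝ (Fin d)

/-- A vector `v` is a (general) subgradient of `f` at `x` when
`f y ≥ f x + ⟪v, y - x⟫ + o(‖y - x‖)` as `y → x`; this is the set of all of them. -/
def subdifferential {d : ℕ} (f : Vec d → ℝ) (x : Vec d) : Set (Vec d) :=
  {v | ∀ c : ℝ, 0 < c → ∀ᶠ y in 𝓝 x, f x + inner ℝ v (y - x) - c * ‖y - x‖ ≤ f y}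

/-- `f` is `δ`-weakly convex: `f + (δ / 2) ‖·‖ ^ 2` is convex. -/
def WeaklyConvex {d : ℕ} (δ : ℝ) (f : Vec d → ℝ) : Prop :=
  ConvexOn ℝ Set.univ fun x => f x + δ / 2 * ‖x‖ ^ 2

/-- A minimizer of `f` over `s` (a fixed choice of one, if there is any). -/
def argminOn {d : ℕ} (s : Set (Vec d)) (f : Vec d → ℝ) : Vec d :=
  Classical.epsilon fun p => p ∈ s ∧ IsMinOn f s p

/-- A maximizer of `f` over `s` (a fixed choice of one, if there is any). -/
def argmaxOn {d : ℕ} (s : Set (Vec d)) (f : Vec d → ℝ) : Vec d :=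
  Classical.epsilon fun p => p ∈ s ∧ IsMaxOn f s p

/-- Euclidean projection onto `s`. -/
def proj {d : ℕ} (s : Set (Vec d)) (z : Vec d) : Vec d :=
  argminOn s fun p => ‖p - z‖

/-- The Moreau envelope `f_γ`. -/
def moreau {d : ℕ} (γ : ℝ) (f : Vec d → ℝ) (x : Vec d) : ℝ :=
  ⨅ p : Vec d, (f p + 1 / (2 * γ) * ‖p - x‖ ^ 2)

/-- The proximal map `prox_{γ f}`. -/
def prox {d : ℕ} (γ : ℝ) (f : Vec d → ℝ) (x : Vec d) : Vec d :=
  argminOn Set.univ fun p => f p + 1 / (2 * γ) * ‖p - x‖ ^ 2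

/-- The objective `F x = max_{y ∈ Y} φ x y`. -/
def maxVal {dx dy : ℕ} (Y : Set (Vec dy)) (φ : Vec dx → Vec dy → ℝ) (x : Vec dx) : ℝ :=
  ⨆ y : Y, φ x y

/-- `X` is a random nearly `ε`-stationary point of `F`: there are random vectors `x'` and `v`
with `v ∈ ∂F(x')`, `𝔼‖v‖ ≤ ε` and `𝔼‖X - x'‖ ≤ ε`. -/
def NearlyStationary {Ω : Type*} [MeasurableSpace Ω] {d : ℕ} (P : Measure Ω)
    (F : Vec d → ℝ) (ε : ℝ) (X : Ω → Vec d) : Prop :=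
  ∃ x' v : Ω → Vec d,
    (∀ᵐ ω ∂P, v ω ∈ subdifferential F (x' ω)) ∧
    Integrable v P ∧ ∫ ω, ‖v ω‖ ∂P ≤ ε ∧
    Integrable (fun ω => X ω - x' ω) P ∧ ∫ ω, ‖X ω - x' ω‖ ∂P ≤ ε

/-- The assumptions on the min-max problem `min_x max_{y ∈ Y} φ x y`. The map `gradY` is
`∇_y φ` (differentiability at a point of `Y` is relative to `Y`, so that `φ x` matters
only on `Y`). The number `Fstar` is the lower bound of the Moreau envelope of `F`. -/
structure ProblemAssumption {dx dy : ℕ} (Y : Set (Vec dy)) (φ : Vec dx → Vec dy → ℝ)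
    (gradY : Vec dx → Vec dy → Vec dy) (γ δ μ L Fstar : ℝ) : Prop where
  weaklyConvex : ∀ y ∈ Y, WeaklyConvex δ fun x => φ x y
  stronglyConcave : ∀ x, StrongConcaveOn Y μ (φ x)
  hasGradient : ∀ x, ∀ y ∈ Y, HasGradientWithinAt (φ x) (gradY x y) Y y
  lipschitz : ∀ y ∈ Y, ∀ x₁ x₂, ‖gradY x₁ y - gradY x₂ y‖ ≤ L * ‖x₁ - x₂‖
  bddBelow : ∀ x, Fstar ≤ moreau γ (maxVal Y φ) x

/-- The assumptions on the stochastic first-order oracle. A sample `s` with law `D` yields the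
estimators `gx x y s` of a subgradient of `φ(·, y)` at `x` and `gy x y s` of `∇_y φ(x, y)`;
both are unbiased with second moment at most `M ^ 2`. -/
structure OracleAssumption {dx dy : ℕ} {S : Type*} [MeasurableSpace S] (D : Measure S)
    (Y : Set (Vec dy)) (φ : Vec dx → Vec dy → ℝ) (gradY : Vec dx → Vec dy → Vec dy)
    (gx : Vec dx → Vec dy → S → Vec dx) (gy : Vec dx → Vec dy → S → Vec dy) (M : ℝ) :
    Prop where
  measurable_gx : Measurable fun q : Vec dx × Vec dy × S => gx q.1 q.2.1 q.2.2
  measurable_gy : Measurable fun q : Vec dx × Vec dy × S => gy q.1 q.2.1 q.2.2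
  memLp_gx : ∀ x, ∀ y ∈ Y, MemLp (gx x y) 2 D
  memLp_gy : ∀ x, ∀ y ∈ Y, MemLp (gy x y) 2 D
  unbiased_gx : ∀ x, ∀ y ∈ Y, ∫ s, gx x y s ∂D ∈ subdifferential (fun u => φ u y) x
  unbiased_gy : ∀ x, ∀ y ∈ Y, ∫ s, gy x y s ∂D = gradY x y
  bound_gx : ∀ x, ∀ y ∈ Y, ∫ s, ‖gx x y s‖ ^ 2 ∂D ≤ M ^ 2
  bound_gy : ∀ x, ∀ y ∈ Y, ∫ s, ‖gy x y s‖ ^ 2 ∂D ≤ M ^ 2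

/-- The variables `x_φ^t`, `y_t`, `x_t` kept by the algorithm. -/
structure State (dx dy : ℕ) where
  xφ : Vec dx
  y : Vec dy
  x : Vec dx

/-- One iteration of single-loop SMAG for min-max problems, with sample `s`. -/
def step {dx dy : ℕ} {S : Type*} (Y : Set (Vec dy)) (gx : Vec dx → Vec dy → S → Vec dx)
    (gy : Vec dx → Vec dy → S → Vec dy) (γ η₀ η₁ : ℝ) (s : S) (z : State dx dy) :
    State dx dy :=
  let xφ_next := z.xφ - η₁ • (gx z.xφ z.y s + (1 / γ) • (z.xφ - z.x))
  let y_next := proj Y (z.y + η₁ • gy z.xφ z.y s)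
  let G := (1 / γ) • (z.x - xφ_next)
  { xφ := xφ_next, y := y_next, x := z.x - η₀ • G }

/-- The state after `t` iterations from `z₀`, iteration `k` using the sample `s k`. -/
def iterate {dx dy : ℕ} {S : Type*} (Y : Set (Vec dy)) (gx : Vec dx → Vec dy → S → Vec dx)
    (gy : Vec dx → Vec dy → S → Vec dy) (γ η₀ η₁ : ℝ) (z₀ : State dx dy) (s : ℕ → S) :
    ℕ → State dx dy
  | 0 => z₀
  | t + 1 => step Y gx gy γ η₀ η₁ (s t) (iterate Y gx gy γ η₀ η₁ z₀ s t)

/-- The constants of the problem: the envelope parameter `γ`, the weak convexity modulus `δ`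
of `φ(·, y)`, a weak convexity modulus `δψ` of the zero function (the second component `Ψ` in
`F = Φ - Ψ`), the strong concavity modulus `μ`, the Lipschitz constant `L` of `∇_y φ(·, y)`
and the bound `M` of the oracle. -/
structure Constants where
  γ : ℝ
  δ : ℝ
  δψ : ℝ
  μ : ℝ
  L : ℝ
  M : ℝ

namespace Constants

def α (c : Constants) : ℝ := min ((1 / c.γ - c.δ) / 2) c.μ

def τ (c : Constants) : ℝ :=
  min (c.γ ^ 2 * c.α ^ 2 / 4)
    (c.μ ^ (3 / 2 : ℝ) * c.γ ^ 2 * c.α ^ (3 / 2 : ℝ) / (4 * c.L))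

def ν (c : Constants) : ℝ := min 1 (2 * c.τ / (c.γ ^ 2 * c.α))

def LF (c : Constants) : ℝ := 2 / (c.γ - c.γ ^ 2 * min c.δψ c.δ)

/-- The step size `η₁` for accuracy `ε`. -/
def η₁ (c : Constants) (ε : ℝ) : ℝ :=
  min (min (c.γ ^ 2 * (1 / c.γ - c.δ) / 2) (1 / (2 * c.LF * c.τ)))
    (min 1 (c.γ ^ 2) * min c.α c.τ * c.ν * c.α / (384 * c.τ * c.M ^ 2) * ε ^ 2)

/-- The step size `η₀` for accuracy `ε`. -/
def η₀ (c : Constants) (ε : ℝ) : ℝ := c.τ * c.η₁ ε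

end Constants

/-- The run of the algorithm with the step sizes for accuracy `ε`. -/
def run {dx dy : ℕ} {S : Type*} (c : Constants) (Y : Set (Vec dy))
    (gx : Vec dx → Vec dy → S → Vec dx) (gy : Vec dx → Vec dy → S → Vec dy)
    (z₀ : State dx dy) (ε : ℝ) (s : ℕ → S) (t : ℕ) : State dx dy :=
  iterate Y gx gy c.γ (c.η₀ ε) (c.η₁ ε) z₀ s t

/-- The initial potential
`P₀ = 2 η₀ / (η₁ γ² α) (𝔼‖x_φ^1 - prox_{γF}(x_0)‖² + 𝔼‖y_1 - y^*(prox_{γF}(x_0))‖²)`. -/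
def initPotential {dx dy : ℕ} {S Ω : Type*} [MeasurableSpace Ω] (P : Measure Ω)
    (ξ : ℕ → Ω → S) (c : Constants) (Y : Set (Vec dy)) (φ : Vec dx → Vec dy → ℝ)
    (gx : Vec dx → Vec dy → S → Vec dx) (gy : Vec dx → Vec dy → S → Vec dy)
    (z₀ : State dx dy) (ε : ℝ) : ℝ :=
  2 * c.η₀ ε / (c.η₁ ε * c.γ ^ 2 * c.α) *
    (∫ ω, ‖(run c Y gx gy z₀ ε (fun k => ξ k ω) 1).xφ - prox c.γ (maxVal Y φ) z₀.x‖ ^ 2 ∂P +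
     ∫ ω, ‖(run c Y gx gy z₀ ε (fun k => ξ k ω) 1).y
        - argmaxOn Y (φ (prox c.γ (maxVal Y φ) z₀.x))‖ ^ 2 ∂P)

/-- The number of iterations that is enough for accuracy `ε`. -/
def iterationBound {dx dy : ℕ} {S Ω : Type*} [MeasurableSpace Ω] (P : Measure Ω)
    (ξ : ℕ → Ω → S) (c : Constants) (Y : Set (Vec dy)) (φ : Vec dx → Vec dy → ℝ)
    (gx : Vec dx → Vec dy → S → Vec dx) (gy : Vec dx → Vec dy → S → Vec dy)
    (z₀ : State dx dy) (Fstar ε : ℝ) : ℝ :=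
  16 * (moreau c.γ (maxVal Y φ) z₀.x - Fstar + initPotential P ξ c Y φ gx gy z₀ ε) /
      (min 1 (c.γ ^ 2)⁻¹ * min c.α c.τ * c.ν * ε ^ 2) *
    max (max (2 / (c.γ ^ 2 * (1 / c.γ - c.δ))) (2 * c.LF * c.τ))
      (384 * c.τ * c.M ^ 2 / (min 1 (c.γ ^ 2) * min c.α c.τ * c.ν * c.α * ε ^ 2))

end

end SMAG

/-! For a centre x, consider the regularized problem φ(u, y) + ‖u - x‖² / (2γ). Because γδ < 1 it is
strongly convex in u and strongly concave in y. Its saddle point is the pair p = prox_{γF}(x), y*(p)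
(`saddle_le`), and F_γ is differentiable with ∇F_γ(x) = (x - p)/γ. An iteration of SMAG is a
projected stochastic descent-ascent step on this problem, followed by an inexact gradient step on
F_γ along G = (x - x_φ)/γ, where the updated x_φ stands in for p.

Two estimates are coupled. First, strong monotonicity of the saddle operator (`monotone_le`) makes
the mean squared distance to the saddle point contract by 1 - ηα, up to noise 9η²M² and the drift of
the saddle point as x moves (`integral_step_le`, `drift_le`). The noise constant is uniform because
‖∇F_γ‖ ≤ M (`norm_gradient_moreau_le`): the proximal force (x_φ - x)/γ is thus a bounded vector plus
a multiple of the tracking error. The drift is controlled by ‖x_{t+1} - x_t‖ = τη‖G‖. Second, F_γ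
decreases by multiples of ‖∇F_γ‖² and ‖G‖², up to a multiple of the tracking error
(`moreau_descent`).

In the potential F_γ + 2τ/(γ²α) · (tracking error) the contraction pays for the error term of the
descent, and the ‖G‖² gained in the descent pays for the drift. Telescoping (`sum_le`) leaves an
average controlled by the initial potential over Tη and by noise of order η; the choices of T_ε and
η₁ make both O(ε²). Near stationarity then follows with x' = prox_{γF}(x) and v = ∇F_γ(x) ∈ ∂F(x'),
since x - x' = γv. -/

namespace SMAG

open Filter

/-! ### Weak and strong convexity along segments -/

section Convexity

/-- Subtract a, divide by s and let s → 0⁺. This one limit yields quadratic growth at a minimizer (l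
= 0), the global subgradient inequality, and the gradient inequality relative to a set. -/
theorem add_le_of_segment {g : ℝ → ℝ} {a b l k : ℝ}
    (hconv : ∀ s : ℝ, 0 < s → s < 1 → g s ≤ (1 - s) * a + s * b - s * (1 - s) * k)
    (hsub : ∀ c : ℝ, 0 < c → ∀ᶠ s in 𝓝[>] (0 : ℝ), a + s * l - c * s ≤ g s) :
    a + l + k ≤ b := by
  refine le_of_forall_pos_le_add fun c hc => ?_
  have h1 : ∀ᶠ s in 𝓝[>] (0 : ℝ), a + l + k ≤ b + c + s * k := by
    filter_upwards [hsub c hc, Ioo_mem_nhdsGT (zero_lt_one' ℝ)] with s hs ⟨hs0, hs1⟩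
    have h2 := hs.trans (hconv s hs0 hs1)
    have h3 : s * (l - c - (b - a - (1 - s) * k)) ≤ 0 := by linarith
    have h4 := nonpos_of_mul_nonpos_right h3 hs0
    linarith
  have h2 : Tendsto (fun s : ℝ => b + c + s * k) (𝓝[>] 0) (𝓝 (b + c)) := by
    have : Continuous fun s : ℝ => b + c + s * k := by fun_prop
    simpa using (this.tendsto 0).mono_left nhdsWithin_le_nhds
  exact ge_of_tendsto h2 h1

variable {d : ℕ} {s : Set (Vec d)} {f : Vec d → ℝ} {m : ℝ}

theorem _root_.StrongConvexOn.segment (hf : StrongConvexOn s m f) {x u : Vec d} (hx : x ∈ s)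
    (hu : u ∈ s) {t : ℝ} (ht0 : 0 < t) (ht1 : t < 1) :
    f (x + t • (u - x)) ≤ (1 - t) * f x + t * f u - t * (1 - t) * (m / 2 * ‖u - x‖ ^ 2) := by
  have h := hf.2 hx hu (sub_nonneg.2 ht1.le) ht0.le (by ring)
  have e : (1 - t) • x + t • u = x + t • (u - x) := by module
  rw [e, norm_sub_rev] at h
  simp only [smul_eq_mul] at h
  linarith

theorem WeaklyConvex.strongConvexOn {δ : ℝ} (hf : WeaklyConvex δ f) :
    StrongConvexOn Set.univ (-δ) f := by
  rw [strongConvexOn_iff_convex]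
  have e : (fun x => f x - -δ / 2 * ‖x‖ ^ 2) = fun x => f x + δ / 2 * ‖x‖ ^ 2 := by
    funext x; ring
  rw [e]; exact hf

/-- The squared distance satisfies the strong convexity inequality with equality, so the moduli add.
The modulus `m` may be negative, which is how weak convexity becomes strong convexity of the
proximal objective. -/
theorem _root_.StrongConvexOn.add_proximal (hf : StrongConvexOn s m f) (k : ℝ) (x : Vec d) :
    StrongConvexOn s (m + k) fun u => f u + k / 2 * ‖u - x‖ ^ 2 := by
  refine ⟨hf.1, fun u hu w hw a b ha hb hab => ?_⟩
  have h := hf.2 hu hw ha hb hab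
  have e : ‖a • u + b • w - x‖ ^ 2 = a * ‖u - x‖ ^ 2 + b * ‖w - x‖ ^ 2 - a * b * ‖u - w‖ ^ 2 := by
    have e1 : a • u + b • w - x = a • (u - x) + b • (w - x) := by
      rw [← sub_eq_zero]
      have : x = (a + b) • x := by rw [hab, one_smul]
      nth_rewrite 1 [this]; module
    have e2 : u - w = (u - x) - (w - x) := by abel
    rw [e1, e2, norm_add_sq_real, norm_sub_sq_real (u - x), norm_smul, norm_smul,
      real_inner_smul_left, real_inner_smul_right, Real.norm_of_nonneg ha, Real.norm_of_nonneg hb]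
    obtain rfl := eq_sub_of_add_eq hab
    ring
  simp only [smul_eq_mul] at h ⊢
  rw [e]
  linarith

theorem _root_.StrongConvexOn.le_of_isMinOn (hf : StrongConvexOn s m f) {p u : Vec d} (hp : p ∈ s)
    (hmin : IsMinOn f s p) (hu : u ∈ s) : f p + m / 2 * ‖u - p‖ ^ 2 ≤ f u := by
  have := add_le_of_segment (g := fun t => f (p + t • (u - p))) (a := f p) (b := f u) (l := 0)
    (k := m / 2 * ‖u - p‖ ^ 2) (fun t h0 h1 => hf.segment hp hu h0 h1) (fun c hc => by
      filter_upwards [Ioo_mem_nhdsGT (zero_lt_one' ℝ)] with t ⟨h0, h1⟩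
      have hmem : p + t • (u - p) ∈ s := hf.1.add_smul_sub_mem hp hu ⟨h0.le, h1.le⟩
      have := hmin hmem
      simp only [Set.mem_ofPred_eq] at this
      nlinarith [mul_pos hc h0])
  linarith

theorem tendsto_segment (x w : Vec d) :
    Tendsto (fun t : ℝ => x + t • w) (𝓝[>] 0) (𝓝 x) := by
  have : Continuous fun t : ℝ => x + t • w := by fun_prop
  simpa using (this.tendsto 0).mono_left nhdsWithin_le_nhds

theorem eventually_le_of_mem_subdifferential {v x : Vec d} (hv : v ∈ subdifferential f x)
    (w : Vec d) {c : ℝ} (hc : 0 < c) :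
    ∀ᶠ t in 𝓝[>] (0 : ℝ), f x + t * inner ℝ v w - c * t ≤ f (x + t • w) := by
  have hc' : 0 < c / (‖w‖ + 1) := by positivity
  filter_upwards [(tendsto_segment x w).eventually (hv _ hc'), self_mem_nhdsWithin] with t ht h0
  rw [add_sub_cancel_left, real_inner_smul_right, norm_smul, Real.norm_of_nonneg (le_of_lt h0)] at ht
  have h0 : 0 < t := h0
  have : c / (‖w‖ + 1) * (t * ‖w‖) ≤ c * t := by
    rw [div_mul_eq_mul_div, div_le_iff₀ (by positivity)]
    nlinarith [mul_pos hc h0, norm_nonneg w]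
  linarith

theorem WeaklyConvex.le_of_mem_subdifferential {δ : ℝ} (hf : WeaklyConvex δ f) {v x : Vec d}
    (hv : v ∈ subdifferential f x) (u : Vec d) :
    f x + inner ℝ v (u - x) - δ / 2 * ‖u - x‖ ^ 2 ≤ f u := by
  have := add_le_of_segment (g := fun t => f (x + t • (u - x)))
    (fun t h0 h1 => hf.strongConvexOn.segment (Set.mem_univ x) (Set.mem_univ u) h0 h1)
    (fun c hc => eventually_le_of_mem_subdifferential hv (u - x) hc)
  linarith

theorem eventually_abs_le_of_hasGradientWithinAt {g y z : Vec d} (hs : Convex ℝ s)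
    (hg : HasGradientWithinAt f g s y) (hy : y ∈ s) (hz : z ∈ s) {c : ℝ} (hc : 0 < c) :
    ∀ᶠ t in 𝓝[>] (0 : ℝ), |f (y + t • (z - y)) - f y - t * inner ℝ g (z - y)| ≤ c * t := by
  rw [hasGradientWithinAt_iff_isLittleO] at hg
  have hc' : 0 < c / (‖z - y‖ + 1) := by positivity
  have ht : Tendsto (fun t : ℝ => y + t • (z - y)) (𝓝[>] 0) (𝓝[s] y) := by
    refine tendsto_nhdsWithin_iff.2 ⟨tendsto_segment y _, ?_⟩
    filter_upwards [Ioo_mem_nhdsGT (zero_lt_one' ℝ)] with t ⟨h0, h1⟩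
    exact hs.add_smul_sub_mem hy hz ⟨h0.le, h1.le⟩
  filter_upwards [ht.eventually (hg.def hc'), self_mem_nhdsWithin] with t ht h0
  have h0 : 0 < t := h0
  rw [add_sub_cancel_left, real_inner_smul_right, norm_smul, Real.norm_of_nonneg h0.le,
    Real.norm_eq_abs] at ht
  refine ht.trans ?_
  rw [div_mul_eq_mul_div, div_le_iff₀ (by positivity)]
  nlinarith [mul_pos hc h0, norm_nonneg (z - y)]

theorem _root_.StrongConcaveOn.le_of_hasGradientWithinAt (hf : StrongConcaveOn s m f) {g y z : Vec d}
    (hg : HasGradientWithinAt f g s y) (hy : y ∈ s) (hz : z ∈ s) :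
    f z ≤ f y + inner ℝ g (z - y) - m / 2 * ‖z - y‖ ^ 2 := by
  have hc : StrongConvexOn s m (-f) := hf.neg
  have := add_le_of_segment (g := fun t => (-f) (y + t • (z - y))) (a := (-f) y) (b := (-f) z)
    (l := -inner ℝ g (z - y)) (fun t h0 h1 => hc.segment hy hz h0 h1) (fun c hc => by
      filter_upwards [eventually_abs_le_of_hasGradientWithinAt hf.1 hg hy hz hc] with t ht
      have := (abs_le.1 ht).2
      simp only [Pi.neg_apply]
      linarith)
  simp only [Pi.neg_apply] at this
  linarith

theorem inner_gradient_nonpos_of_isMaxOn (hs : Convex ℝ s) {g y z : Vec d}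
    (hg : HasGradientWithinAt f g s y) (hy : y ∈ s) (hmax : IsMaxOn f s y) (hz : z ∈ s) :
    inner ℝ g (z - y) ≤ 0 := by
  refine le_of_forall_pos_le_add fun c hc => ?_
  obtain ⟨t, ht, h0, h1⟩ := ((eventually_abs_le_of_hasGradientWithinAt hs hg hy hz hc).and
    (Ioo_mem_nhdsGT (zero_lt_one' ℝ))).exists
  have h2 := (abs_le.1 ht).1
  have h3 : f (y + t • (z - y)) ≤ f y := hmax (hs.add_smul_sub_mem hy hz ⟨h0.le, h1.le⟩)
  have h4 : t * (inner ℝ g (z - y) - c) ≤ 0 := by linarith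
  have := nonpos_of_mul_nonpos_right h4 h0
  linarith

theorem exists_isMinOn_of_quadratic_lower_bound (hs : IsClosed s) (hf : ContinuousOn f s)
    {x₀ v : Vec d} (hx₀ : x₀ ∈ s) {a : ℝ} (hm : 0 < m)
    (h : ∀ u ∈ s, a + inner ℝ v (u - x₀) + m / 2 * ‖u - x₀‖ ^ 2 ≤ f u) :
    ∃ p ∈ s, IsMinOn f s p := by
  refine hf.exists_isMinOn' hs hx₀ ?_
  -- Outside the ball of radius 1 + 2K/m about x₀ the quadratic term outweighs both the linear term
  -- and the gap f x₀ - a, which gives coercivity.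
  set K := ‖v‖ + |f x₀ - a|
  have hK : 0 ≤ K := by positivity
  have h1 : ∀ᶠ u in cocompact (Vec d), ‖x₀‖ + 1 + 2 * K / m ≤ ‖u‖ :=
    (tendsto_norm_cocompact_atTop (E := Vec d)).eventually_ge_atTop _
  rw [eventually_inf_principal]
  filter_upwards [h1] with u hu hus
  have h2 := h u hus
  have h3 : 1 + 2 * K / m ≤ ‖u - x₀‖ := by
    have := norm_sub_norm_le u x₀
    linarith
  have h4 : -(‖v‖ * ‖u - x₀‖) ≤ inner ℝ v (u - x₀) := by
    have := abs_real_inner_le_norm v (u - x₀)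
    exact (abs_le.1 this).1
  set r := ‖u - x₀‖
  have h5 : 1 ≤ r := by have : 0 ≤ 2 * K / m := by positivity
                        linarith
  have h6 : K ≤ m / 2 * r := by
    have : 2 * K / m ≤ r := by linarith
    rw [div_le_iff₀ hm] at this
    linarith
  have h7 : K * r ≤ m / 2 * r ^ 2 := by nlinarith
  have h8 : |f x₀ - a| ≤ |f x₀ - a| * r := le_mul_of_one_le_right (abs_nonneg _) h5
  have h9 := le_abs_self (f x₀ - a)
  have : K * r = ‖v‖ * r + |f x₀ - a| * r := by ring
  linarith

theorem argminOn_spec (h : ∃ p ∈ s, IsMinOn f s p) :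
    argminOn s f ∈ s ∧ IsMinOn f s (argminOn s f) :=
  Classical.epsilon_spec (p := fun p => p ∈ s ∧ IsMinOn f s p) h

theorem argmaxOn_spec (h : ∃ p ∈ s, IsMaxOn f s p) :
    argmaxOn s f ∈ s ∧ IsMaxOn f s (argmaxOn s f) :=
  Classical.epsilon_spec (p := fun p => p ∈ s ∧ IsMaxOn f s p) h

end Convexity

/-! ### Euclidean projection -/

section Projection

variable {d : ℕ} {s : Set (Vec d)}

theorem proj_spec (hs : IsClosed s) (hne : s.Nonempty) (z : Vec d) :
    proj s z ∈ s ∧ ∀ w ∈ s, ‖proj s z - z‖ ≤ ‖w - z‖ := by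
  obtain ⟨p, hp, hd⟩ := hs.exists_infDist_eq_dist hne z
  have := argminOn_spec (s := s) (f := fun p => ‖p - z‖) ⟨p, hp, fun w hw => by
    simp only [Set.mem_ofPred_eq]
    rw [← dist_eq_norm, ← dist_eq_norm, dist_comm p, ← hd, dist_comm w]
    exact Metric.infDist_le_dist_of_mem hw⟩
  exact ⟨this.1, fun w hw => this.2 hw⟩

/-- The squared distance to z is 2-strongly convex, and its quadratic growth at the minimizer is
this obtuse-angle inequality. -/
theorem inner_sub_proj_nonpos (hs : IsClosed s) (hc : Convex ℝ s) (z : Vec d) {w : Vec d}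
    (hw : w ∈ s) : inner ℝ (z - proj s z) (w - proj s z) ≤ 0 := by
  obtain ⟨hp, hmin⟩ := proj_spec hs ⟨w, hw⟩ z
  have : StrongConvexOn s 2 fun u : Vec d => 0 + 2 / 2 * ‖u - z‖ ^ 2 := by
    have h0 : StrongConvexOn s 0 fun _ : Vec d => (0 : ℝ) :=
      strongConvexOn_zero.2 (convexOn_const 0 hc)
    simpa using h0.add_proximal 2 z
  have h := this.le_of_isMinOn hp (fun u hu => by
    have := hmin u hu
    simp only [Set.mem_ofPred_eq]
    gcongr) hw
  have e : w - z = (w - proj s z) - (z - proj s z) := by abel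
  have e2 : ‖proj s z - z‖ = ‖z - proj s z‖ := norm_sub_rev _ _
  rw [e, norm_sub_sq_real (w - proj s z), e2, real_inner_comm] at h
  linarith

theorem norm_proj_sub_le (hs : IsClosed s) (hc : Convex ℝ s) (z : Vec d) {w : Vec d}
    (hw : w ∈ s) : ‖proj s z - w‖ ≤ ‖z - w‖ := by
  have h := inner_sub_proj_nonpos hs hc z hw
  have e : z - w = (z - proj s z) - (w - proj s z) := by abel
  rw [← sq_le_sq₀ (norm_nonneg _) (norm_nonneg _), e, norm_sub_sq_real (z - proj s z),
    norm_sub_rev (proj s z)]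
  nlinarith [sq_nonneg ‖z - proj s z‖]

theorem norm_proj_sub_proj_le (hs : IsClosed s) (hc : Convex ℝ s) (hne : s.Nonempty)
    (z w : Vec d) : ‖proj s z - proj s w‖ ≤ ‖z - w‖ := by
  have h1 := inner_sub_proj_nonpos hs hc z (proj_spec hs hne w).1
  have h2 := inner_sub_proj_nonpos hs hc w (proj_spec hs hne z).1
  set a := proj s z
  set b := proj s w
  have h3 : inner ℝ (a - b) (a - b) ≤ inner ℝ (z - w) (a - b) := by
    simp only [inner_sub_left, inner_sub_right] at h1 h2 ⊢
    linarith
  rw [real_inner_self_eq_norm_sq] at h3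
  have h4 := h3.trans (real_inner_le_norm _ _)
  by_contra! hlt
  have : 0 < ‖a - b‖ := (norm_nonneg _).trans_lt hlt
  nlinarith

theorem continuous_proj (hs : IsClosed s) (hc : Convex ℝ s) (hne : s.Nonempty) :
    Continuous (proj s) :=
  (LipschitzWith.of_dist_le_mul (K := 1) fun z w => by
    simpa [dist_eq_norm] using norm_proj_sub_proj_le hs hc hne z w).continuous

end Projection

/-- A weakly convex / strongly concave problem whose functions `φ(·, y)` have a subgradient of norm
at most `M` at every point. -/
structure MinMaxProblem {dx dy : ℕ} (Y : Set (Vec dy)) (φ : Vec dx → Vec dy → ℝ)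
    (gradY : Vec dx → Vec dy → Vec dy) (γ δ μ L M : ℝ) : Prop where
  closed : IsClosed Y
  convex : Convex ℝ Y
  nonempty : Y.Nonempty
  γ_pos : 0 < γ
  δ_nonneg : 0 ≤ δ
  γδ_lt : γ * δ < 1
  μ_pos : 0 < μ
  weaklyConvex : ∀ y ∈ Y, WeaklyConvex δ fun x => φ x y
  stronglyConcave : ∀ x, StrongConcaveOn Y μ (φ x)
  hasGradient : ∀ x, ∀ y ∈ Y, HasGradientWithinAt (φ x) (gradY x y) Y y
  lipschitz : ∀ y ∈ Y, ∀ x₁ x₂, ‖gradY x₁ y - gradY x₂ y‖ ≤ L * ‖x₁ - x₂‖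
  exists_subgradient : ∀ x, ∀ y ∈ Y, ∃ v ∈ subdifferential (fun u => φ u y) x, ‖v‖ ≤ M

/-! ### Proximal point, Moreau envelope and the regularized saddle problem -/

namespace MinMaxProblem

variable {dx dy : ℕ} {Y : Set (Vec dy)} {φ : Vec dx → Vec dy → ℝ}
  {gradY : Vec dx → Vec dy → Vec dy} {γ δ μ L M : ℝ}

theorem rho_pos (h : MinMaxProblem Y φ gradY γ δ μ L M) : 0 < 1 / γ - δ := by
  have := h.γ_pos
  rw [sub_pos, lt_div_iff₀ this]
  linarith [h.γδ_lt]

theorem continuousOn (h : MinMaxProblem Y φ gradY γ δ μ L M) (x : Vec dx) :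
    ContinuousOn (φ x) Y := fun y hy =>
  (h.hasGradient x y hy).differentiableWithinAt.continuousWithinAt

theorem le_gradient (h : MinMaxProblem Y φ gradY γ δ μ L M) (x : Vec dx) {y z : Vec dy}
    (hy : y ∈ Y) (hz : z ∈ Y) :
    φ x z ≤ φ x y + inner ℝ (gradY x y) (z - y) - μ / 2 * ‖z - y‖ ^ 2 :=
  (h.stronglyConcave x).le_of_hasGradientWithinAt (h.hasGradient x y hy) hy hz

theorem argmax_spec (h : MinMaxProblem Y φ gradY γ δ μ L M) (x : Vec dx) :
    argmaxOn Y (φ x) ∈ Y ∧ IsMaxOn (φ x) Y (argmaxOn Y (φ x)) := by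
  obtain ⟨y₀, hy₀⟩ := h.nonempty
  obtain ⟨p, hp, hm⟩ := exists_isMinOn_of_quadratic_lower_bound (f := fun y => -φ x y)
    (v := -gradY x y₀) (a := -φ x y₀) h.closed (h.continuousOn x).neg hy₀ h.μ_pos (fun u hu => by
      have := h.le_gradient x hy₀ hu
      rw [inner_neg_left]
      linarith)
  refine argmaxOn_spec ⟨p, hp, ?_⟩
  simpa using hm.neg

theorem argmax_mem (h : MinMaxProblem Y φ gradY γ δ μ L M) (x : Vec dx) :
    argmaxOn Y (φ x) ∈ Y := (h.argmax_spec x).1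

theorem le_argmax (h : MinMaxProblem Y φ gradY γ δ μ L M) (x : Vec dx) {y : Vec dy} (hy : y ∈ Y) :
    φ x y ≤ φ x (argmaxOn Y (φ x)) := (h.argmax_spec x).2 hy

theorem le_argmax_sub (h : MinMaxProblem Y φ gradY γ δ μ L M) (x : Vec dx) {y : Vec dy}
    (hy : y ∈ Y) :
    φ x y + μ / 2 * ‖y - argmaxOn Y (φ x)‖ ^ 2 ≤ φ x (argmaxOn Y (φ x)) := by
  have hc : StrongConvexOn Y μ (-φ x) := (h.stronglyConcave x).neg
  have := hc.le_of_isMinOn (h.argmax_mem x) (h.argmax_spec x).2.neg hy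
  simp only [Pi.neg_apply] at this
  linarith

theorem maxVal_eq (h : MinMaxProblem Y φ gradY γ δ μ L M) (x : Vec dx) :
    maxVal Y φ x = φ x (argmaxOn Y (φ x)) := by
  have : Nonempty Y := h.nonempty.to_subtype
  refine le_antisymm (ciSup_le fun y => h.le_argmax x y.2) ?_
  exact le_ciSup (f := fun y : Y => φ x y)
    ⟨_, by rintro _ ⟨y, rfl⟩; exact h.le_argmax x y.2⟩ ⟨_, h.argmax_mem x⟩

theorem le_maxVal (h : MinMaxProblem Y φ gradY γ δ μ L M) (x : Vec dx) {y : Vec dy} (hy : y ∈ Y) :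
    φ x y ≤ maxVal Y φ x := (h.maxVal_eq x).symm ▸ h.le_argmax x hy

/-- Strong concavity of φ(x₁, ·), quadratic growth at y₁ and first-order optimality of y₂ combine to
μ‖y₁ - y₂‖² ≤ ⟪∇φ(x₁, y₂) - ∇φ(x₂, y₂), y₁ - y₂⟫, so only the Lipschitz dependence of the gradient
on x enters. -/
theorem norm_argmax_sub_le (h : MinMaxProblem Y φ gradY γ δ μ L M) (x₁ x₂ : Vec dx) :
    μ * ‖argmaxOn Y (φ x₁) - argmaxOn Y (φ x₂)‖ ≤ L * ‖x₁ - x₂‖ := by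
  set y₁ := argmaxOn Y (φ x₁) with hy₁
  set y₂ := argmaxOn Y (φ x₂) with hy₂
  have m₁ : y₁ ∈ Y := h.argmax_mem x₁
  have m₂ : y₂ ∈ Y := h.argmax_mem x₂
  have h1 := h.le_gradient x₁ m₂ m₁
  have h2 := h.le_argmax_sub x₁ m₂
  have h3 := inner_gradient_nonpos_of_isMaxOn h.convex (h.hasGradient x₂ y₂ m₂) m₂
    (h.argmax_spec x₂).2 m₁
  have h4 := (real_inner_le_norm (gradY x₁ y₂ - gradY x₂ y₂) (y₁ - y₂)).trans
    (mul_le_mul_of_nonneg_right (h.lipschitz y₂ m₂ x₁ x₂) (norm_nonneg _))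
  rw [← hy₁, norm_sub_rev y₂] at h2
  rw [inner_sub_left] at h4
  by_contra! hlt
  have hL : 0 ≤ L * ‖x₁ - x₂‖ := (norm_nonneg _).trans (h.lipschitz y₂ m₂ x₁ x₂)
  have hpos : 0 < ‖y₁ - y₂‖ := by
    by_contra! h0
    have := le_antisymm h0 (norm_nonneg _)
    rw [this, mul_zero] at hlt
    linarith
  nlinarith

theorem continuous_argmax (h : MinMaxProblem Y φ gradY γ δ μ L M) :
    Continuous fun x => argmaxOn Y (φ x) := by
  refine (LipschitzWith.of_dist_le_mul (K := (L / μ).toNNReal) fun x z => ?_).continuous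
  rw [dist_eq_norm, dist_eq_norm]
  have h1 := h.norm_argmax_sub_le x z
  have : ‖argmaxOn Y (φ x) - argmaxOn Y (φ z)‖ ≤ L / μ * ‖x - z‖ := by
    rw [div_mul_eq_mul_div, le_div_iff₀ h.μ_pos]
    linarith
  exact this.trans (mul_le_mul_of_nonneg_right (Real.le_coe_toNNReal _) (norm_nonneg _))

theorem weaklyConvex_maxVal (h : MinMaxProblem Y φ gradY γ δ μ L M) :
    WeaklyConvex δ (maxVal Y φ) := by
  refine ⟨convex_univ, fun x _ z _ a b ha hb hab => ?_⟩
  -- The maximizer at the convex combination is one fixed y for which the whole inequality can be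
  -- read off.
  have m := h.argmax_mem (a • x + b • z)
  have h1 := (h.weaklyConvex _ m).2 (Set.mem_univ x) (Set.mem_univ z) ha hb hab
  have h2 := mul_le_mul_of_nonneg_left (h.le_maxVal x m) ha
  have h3 := mul_le_mul_of_nonneg_left (h.le_maxVal z m) hb
  simp only [smul_eq_mul] at h1 ⊢
  rw [h.maxVal_eq (a • x + b • z)]
  linarith

theorem continuous_maxVal (h : MinMaxProblem Y φ gradY γ δ μ L M) : Continuous (maxVal Y φ) := by
  have h1 : ConvexOn ℝ Set.univ fun x => maxVal Y φ x + δ / 2 * ‖x‖ ^ 2 := h.weaklyConvex_maxVal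
  have h2 : Continuous fun x => maxVal Y φ x + δ / 2 * ‖x‖ ^ 2 := h1.locallyLipschitz.continuous
  have h3 : Continuous fun x : Vec dx => δ / 2 * ‖x‖ ^ 2 := by fun_prop
  have h4 := h2.sub h3
  have e : (fun x => maxVal Y φ x + δ / 2 * ‖x‖ ^ 2) - (fun x => δ / 2 * ‖x‖ ^ 2) = maxVal Y φ := by
    funext x; simp
  rwa [e] at h4

theorem strongConvexOn_proximal {f : Vec dx → ℝ} (hf : WeaklyConvex δ f) (γ : ℝ) (x : Vec dx) :
    StrongConvexOn Set.univ (1 / γ - δ) fun u => f u + 1 / (2 * γ) * ‖u - x‖ ^ 2 := by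
  have h := hf.strongConvexOn.add_proximal (1 / γ) x
  have e : -δ + 1 / γ = 1 / γ - δ := by ring
  have e2 : 1 / γ / 2 = 1 / (2 * γ) := by rw [div_div, mul_comm]
  rwa [e, e2] at h

theorem isMinOn_prox (h : MinMaxProblem Y φ gradY γ δ μ L M) (x : Vec dx) :
    IsMinOn (fun p => maxVal Y φ p + 1 / (2 * γ) * ‖p - x‖ ^ 2) Set.univ
      (prox γ (maxVal Y φ) x) := by
  -- Coercivity comes from a single member of the family: F ≥ φ(·, y₀), whose subgradient inequality
  -- plus the proximal term is a quadratic minorant of modulus 1/γ - δ.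
  obtain ⟨y₀, hy₀⟩ := h.nonempty
  obtain ⟨v, hv, -⟩ := h.exists_subgradient x y₀ hy₀
  have hc : Continuous fun p => maxVal Y φ p + 1 / (2 * γ) * ‖p - x‖ ^ 2 :=
    h.continuous_maxVal.add (by fun_prop)
  refine (argminOn_spec (exists_isMinOn_of_quadratic_lower_bound (v := v) (a := φ x y₀)
    isClosed_univ hc.continuousOn (Set.mem_univ x) h.rho_pos fun u _ => ?_)).2
  have h1 := (h.weaklyConvex y₀ hy₀).le_of_mem_subdifferential hv u
  have h2 := h.le_maxVal u hy₀
  have e2 : 1 / γ / 2 = 1 / (2 * γ) := by rw [div_div, mul_comm]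
  rw [← e2]
  linarith

theorem proximal_prox_le (h : MinMaxProblem Y φ gradY γ δ μ L M) (x u : Vec dx) :
    maxVal Y φ (prox γ (maxVal Y φ) x) + 1 / (2 * γ) * ‖prox γ (maxVal Y φ) x - x‖ ^ 2
      ≤ maxVal Y φ u + 1 / (2 * γ) * ‖u - x‖ ^ 2 :=
  h.isMinOn_prox x (Set.mem_univ u)

theorem prox_le (h : MinMaxProblem Y φ gradY γ δ μ L M) (x u : Vec dx) :
    maxVal Y φ (prox γ (maxVal Y φ) x) + 1 / (2 * γ) * ‖prox γ (maxVal Y φ) x - x‖ ^ 2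
      + (1 / γ - δ) / 2 * ‖u - prox γ (maxVal Y φ) x‖ ^ 2
      ≤ maxVal Y φ u + 1 / (2 * γ) * ‖u - x‖ ^ 2 :=
  (strongConvexOn_proximal h.weaklyConvex_maxVal γ x).le_of_isMinOn (Set.mem_univ _)
    (h.isMinOn_prox x) (Set.mem_univ u)

theorem moreau_eq (h : MinMaxProblem Y φ gradY γ δ μ L M) (x : Vec dx) :
    moreau γ (maxVal Y φ) x = maxVal Y φ (prox γ (maxVal Y φ) x)
      + 1 / (2 * γ) * ‖prox γ (maxVal Y φ) x - x‖ ^ 2 := by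
  refine le_antisymm (ciInf_le ?_ (prox γ (maxVal Y φ) x)) (le_ciInf (h.proximal_prox_le x))
  refine ⟨_, Set.forall_mem_range.2 (h.proximal_prox_le x)⟩

theorem moreau_le (h : MinMaxProblem Y φ gradY γ δ μ L M) (x u : Vec dx) :
    moreau γ (maxVal Y φ) x ≤ maxVal Y φ u + 1 / (2 * γ) * ‖u - x‖ ^ 2 := by
  rw [h.moreau_eq]
  exact h.proximal_prox_le x u

/-- Add the two quadratic growth inequalities, each tested at the other proximal point; the values
of F cancel. -/
theorem norm_prox_sub_le (h : MinMaxProblem Y φ gradY γ δ μ L M) (x z : Vec dx) :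
    γ * (1 / γ - δ) * ‖prox γ (maxVal Y φ) x - prox γ (maxVal Y φ) z‖ ≤ ‖x - z‖ := by
  have h1 := h.prox_le x (prox γ (maxVal Y φ) z)
  have h2 := h.prox_le z (prox γ (maxVal Y φ) x)
  set p := prox γ (maxVal Y φ) x
  set q := prox γ (maxVal Y φ) z
  have hγ := h.γ_pos
  have e : ‖q - x‖ ^ 2 - ‖p - x‖ ^ 2 + (‖p - z‖ ^ 2 - ‖q - z‖ ^ 2)
      = 2 * inner ℝ (x - z) (p - q) := by
    simp only [norm_sub_sq_real, inner_sub_left, inner_sub_right, real_inner_comm x p,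
      real_inner_comm x q, real_inner_comm z p, real_inner_comm z q]
    ring
  rw [norm_sub_rev q p] at h1
  have h3 : (1 / γ - δ) * ‖p - q‖ ^ 2 ≤ 1 / γ * inner ℝ (x - z) (p - q) := by
    have e2 : 1 / γ / 2 = 1 / (2 * γ) := by rw [div_div, mul_comm]
    have : (1 / γ - δ) * ‖p - q‖ ^ 2 ≤ 1 / γ / 2 * (‖q - x‖ ^ 2 - ‖p - x‖ ^ 2
      + (‖p - z‖ ^ 2 - ‖q - z‖ ^ 2)) := by
      rw [e2]; linarith
    rw [e] at this
    linarith
  have h4 := mul_le_mul_of_nonneg_left h3 hγ.le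
  rw [← mul_assoc γ (1 / γ), mul_one_div_cancel hγ.ne', one_mul] at h4
  have h5 := h4.trans (real_inner_le_norm _ _)
  by_contra! hlt
  have hpos : 0 < ‖p - q‖ := by
    by_contra! h0
    have := le_antisymm h0 (norm_nonneg _)
    rw [this, mul_zero] at hlt
    linarith [norm_nonneg (x - z)]
  nlinarith

theorem continuous_prox (h : MinMaxProblem Y φ gradY γ δ μ L M) :
    Continuous (prox γ (maxVal Y φ)) := by
  have hk : 0 < γ * (1 / γ - δ) := mul_pos h.γ_pos h.rho_pos
  refine (LipschitzWith.of_dist_le_mul (K := (1 / (γ * (1 / γ - δ))).toNNReal)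
    fun x z => ?_).continuous
  rw [dist_eq_norm, dist_eq_norm, Real.coe_toNNReal _ (by positivity), one_div_mul_eq_div,
    le_div_iff₀ hk, mul_comm]
  exact h.norm_prox_sub_le x z

/-- The proximal point of x is a competitor at z. Exchanging x and z gives the matching lower bound,
which is how differentiability of the envelope follows from continuity of the proximal map. -/
theorem moreau_le_add (h : MinMaxProblem Y φ gradY γ δ μ L M) (x z : Vec dx) :
    moreau γ (maxVal Y φ) z ≤ moreau γ (maxVal Y φ) x
      + inner ℝ ((1 / γ) • (x - prox γ (maxVal Y φ) x)) (z - x) + 1 / (2 * γ) * ‖z - x‖ ^ 2 := by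
  have h1 := h.moreau_le z (prox γ (maxVal Y φ) x)
  rw [h.moreau_eq x]
  set p := prox γ (maxVal Y φ) x
  have e : p - z = (p - x) - (z - x) := by abel
  have e2 : x - p = -(p - x) := by abel
  have e3 : 1 / γ = 2 * (1 / (2 * γ)) := by have := h.γ_pos; field_simp
  rw [e, norm_sub_sq_real] at h1
  rw [real_inner_smul_left, e2, inner_neg_left, e3]
  linarith

theorem hasGradientAt_moreau (h : MinMaxProblem Y φ gradY γ δ μ L M) (x : Vec dx) :
    HasGradientAt (moreau γ (maxVal Y φ)) ((1 / γ) • (x - prox γ (maxVal Y φ) x)) x := by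
  set g := fun x => (1 / γ) • (x - prox γ (maxVal Y φ) x) with hg
  have hgc : Continuous g := by
    have := h.continuous_prox
    fun_prop
  have hγ := h.γ_pos
  rw [hasGradientAt_iff_isLittleO, Asymptotics.isLittleO_iff]
  intro c hc
  have h1 : ∀ᶠ z in 𝓝 x, ‖g z - g x‖ < c / 2 := by
    have := (hgc.tendsto x).eventually (Metric.ball_mem_nhds _ (half_pos hc))
    simpa [dist_eq_norm] using this
  have h2 : ∀ᶠ z in 𝓝 x, ‖z - x‖ < γ * c := by
    have := Metric.ball_mem_nhds x (mul_pos hγ hc)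
    filter_upwards [this] with z hz
    simpa [dist_eq_norm] using hz
  filter_upwards [h1, h2] with z hz1 hz2
  have h3 := h.moreau_le_add x z
  have h4 := h.moreau_le_add z x
  have h5 : 1 / (2 * γ) * ‖z - x‖ ^ 2 ≤ c / 2 * ‖z - x‖ := by
    have : 1 / (2 * γ) * ‖z - x‖ ≤ c / 2 := by
      rw [one_div_mul_eq_div, div_le_iff₀ (by positivity)]
      linarith
    nlinarith [norm_nonneg (z - x)]
  have h6 : -(c / 2 * ‖z - x‖) ≤ inner ℝ (g z - g x) (z - x) := by
    have h7 := (abs_le.1 (abs_real_inner_le_norm (g z - g x) (z - x))).1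
    have h8 := mul_le_mul_of_nonneg_right hz1.le (norm_nonneg (z - x))
    linarith
  rw [← neg_sub z x, inner_neg_right, norm_neg] at h4
  rw [inner_sub_left] at h6
  rw [Real.norm_eq_abs, abs_le]
  simp only [hg] at h6 ⊢
  constructor <;> nlinarith [norm_nonneg (z - x)]

theorem gradient_moreau (h : MinMaxProblem Y φ gradY γ δ μ L M) (x : Vec dx) :
    gradient (moreau γ (maxVal Y φ)) x = (1 / γ) • (x - prox γ (maxVal Y φ) x) :=
  (h.hasGradientAt_moreau x).gradient

theorem continuous_gradient_moreau (h : MinMaxProblem Y φ gradY γ δ μ L M) :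
    Continuous (gradient (moreau γ (maxVal Y φ))) := by
  have := h.continuous_prox
  rw [show gradient (moreau γ (maxVal Y φ)) = fun x => (1 / γ) • (x - prox γ (maxVal Y φ) x) from
    funext h.gradient_moreau]
  fun_prop

/-- Expanding the optimality of p about p gives the subgradient inequality with error ‖y - p‖² /
(2γ), which is o(‖y - p‖). -/
theorem gradient_moreau_mem_subdifferential (h : MinMaxProblem Y φ gradY γ δ μ L M) (x : Vec dx) :
    gradient (moreau γ (maxVal Y φ)) x ∈
      subdifferential (maxVal Y φ) (prox γ (maxVal Y φ) x) := by
  intro c hc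
  have hγ := h.γ_pos
  rw [h.gradient_moreau]
  filter_upwards [Metric.ball_mem_nhds (prox γ (maxVal Y φ) x) (mul_pos (mul_pos two_pos hγ) hc)]
    with y hy
  have h1 := h.proximal_prox_le x y
  set p := prox γ (maxVal Y φ) x
  rw [Metric.mem_ball, dist_eq_norm] at hy
  have h2 : 1 / (2 * γ) * ‖y - p‖ ^ 2 ≤ c * ‖y - p‖ := by
    have : 1 / (2 * γ) * ‖y - p‖ ≤ c := by
      rw [one_div_mul_eq_div, div_le_iff₀ (by positivity)]
      linarith
    nlinarith [norm_nonneg (y - p)]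
  have e : y - x = (y - p) + (p - x) := by abel
  have e2 : x - p = -(p - x) := by abel
  have e3 : 1 / γ = 2 * (1 / (2 * γ)) := by field_simp
  rw [e, norm_add_sq_real, real_inner_comm] at h1
  rw [real_inner_smul_left, e2, inner_neg_left, e3]
  linarith

/-- The proximal point and its best response form a saddle point of the regularized problem. -/
theorem saddle_le (h : MinMaxProblem Y φ gradY γ δ μ L M) (x u : Vec dx) :
    φ (prox γ (maxVal Y φ) x) (argmaxOn Y (φ (prox γ (maxVal Y φ) x)))
        + 1 / (2 * γ) * ‖prox γ (maxVal Y φ) x - x‖ ^ 2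
        + (1 / γ - δ) / 2 * ‖u - prox γ (maxVal Y φ) x‖ ^ 2
      ≤ φ u (argmaxOn Y (φ (prox γ (maxVal Y φ) x))) + 1 / (2 * γ) * ‖u - x‖ ^ 2 := by
  set p := prox γ (maxVal Y φ) x with hp
  have hrho := h.rho_pos
  -- A Danskin argument in place of a minimax theorem. Compare p with p + t(w - p) at the maximizer
  -- Z t of the latter; convexity in u and φ p (Z t) ≤ φ p (y*(p)) give the inequality between p and
  -- w at Z t after division by t, and Z t → y*(p) as t → 0.
  have key : ∀ w : Vec dx, φ p (argmaxOn Y (φ p)) + 1 / (2 * γ) * ‖p - x‖ ^ 2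
      ≤ φ w (argmaxOn Y (φ p)) + 1 / (2 * γ) * ‖w - x‖ ^ 2 := by
    intro w
    set Z : ℝ → Vec dy := fun t => argmaxOn Y (φ (p + t • (w - p)))
    have hZm : ∀ t, Z t ∈ Y := fun t => h.argmax_mem _
    have hZ : Tendsto Z (𝓝[>] 0) (𝓝[Y] (argmaxOn Y (φ p))) :=
      tendsto_nhdsWithin_iff.2 ⟨(h.continuous_argmax.tendsto p).comp (tendsto_segment p _),
        Eventually.of_forall hZm⟩
    have hA : ∀ q, Tendsto (fun t => φ q (Z t)) (𝓝[>] 0) (𝓝 (φ q (argmaxOn Y (φ p)))) := fun q =>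
      (h.continuousOn q _ (h.argmax_mem p)).tendsto.comp hZ
    refine le_of_tendsto_of_tendsto ((hA p).add_const _) ((hA w).add_const _) ?_
    filter_upwards [Ioo_mem_nhdsGT (zero_lt_one' ℝ)] with t ⟨h0, h1⟩
    have h2 := (strongConvexOn_proximal (h.weaklyConvex _ (hZm t)) γ x).segment
      (Set.mem_univ p) (Set.mem_univ w) h0 h1
    have h3 := h.proximal_prox_le x (p + t • (w - p))
    rw [← hp, h.maxVal_eq (p + t • (w - p)), h.maxVal_eq p] at h3
    have h4 := h.le_argmax p (hZm t)
    have h5 : 0 ≤ t * (1 - t) * ((1 / γ - δ) / 2 * ‖w - p‖ ^ 2) := by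
      have : 0 ≤ 1 - t := by linarith
      positivity
    have h6 : t * ((φ p (Z t) + 1 / (2 * γ) * ‖p - x‖ ^ 2)
      - (φ w (Z t) + 1 / (2 * γ) * ‖w - x‖ ^ 2)) ≤ 0 := by
      linarith
    have := nonpos_of_mul_nonpos_right h6 h0
    linarith
  exact (strongConvexOn_proximal (h.weaklyConvex _ (h.argmax_mem p)) γ x).le_of_isMinOn
    (Set.mem_univ p) (fun w _ => key w) (Set.mem_univ u)

/-- At each point only some subgradient is known to have norm at most M, so g = ∇F_γ(x) cannot be
bounded merely by being a subgradient at p. Instead, optimality of p against p + s g is played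
against the bounded subgradient at p + s g, and s → 0. -/
theorem norm_gradient_moreau_le (h : MinMaxProblem Y φ gradY γ δ μ L M) (x : Vec dx) :
    ‖gradient (moreau γ (maxVal Y φ)) x‖ ≤ M := by
  set g := gradient (moreau γ (maxVal Y φ)) x with hg
  have hγ := h.γ_pos
  have hgx : x - prox γ (maxVal Y φ) x = γ • g := by
    rw [hg, h.gradient_moreau, smul_smul, mul_one_div_cancel hγ.ne', one_smul]
  rcases eq_or_ne g 0 with h0 | h0
  · obtain ⟨y, hy⟩ := h.nonempty
    obtain ⟨v, -, hv⟩ := h.exists_subgradient x y hy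
    rw [h0, norm_zero]
    exact (norm_nonneg v).trans hv
  have hpos : 0 < ‖g‖ := norm_pos_iff.2 h0
  set p := prox γ (maxVal Y φ) x with hp
  set y := argmaxOn Y (φ p) with hy
  have key : ∀ s : ℝ, 0 < s → ‖g‖ ≤ M + s * ((δ / 2 + 1 / (2 * γ)) * ‖g‖) := by
    intro s hs
    obtain ⟨v, hv, hvM⟩ := h.exists_subgradient (p + s • g) y (h.argmax_mem p)
    have h1 := (h.weaklyConvex y (h.argmax_mem p)).le_of_mem_subdifferential hv p
    have h2 := h.saddle_le x (p + s • g)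
    rw [← hp, ← hy] at h2
    have e1 : p - (p + s • g) = -(s • g) := by abel
    have e2 : p - x = -(γ • g) := by rw [← hgx]; abel
    have e3 : p + s • g - x = (s - γ) • g := by
      rw [sub_smul, ← hgx]; abel
    have e4 : p + s • g - p = s • g := by abel
    rw [e1, norm_neg, inner_neg_right, real_inner_smul_right, norm_smul] at h1
    rw [e2, e3, e4, norm_neg, norm_smul, norm_smul, norm_smul, mul_pow, mul_pow, mul_pow] at h2
    simp only [Real.norm_eq_abs, mul_pow, sq_abs] at h1 h2
    have h3 : inner ℝ v g ≤ M * ‖g‖ := (real_inner_le_norm v g).trans (by gcongr)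
    have h4 : 0 ≤ (1 / γ - δ) / 2 * (s ^ 2 * ‖g‖ ^ 2) := by
      have := h.rho_pos
      positivity
    have e5 : 1 / (2 * γ) * ((s - γ) ^ 2 * ‖g‖ ^ 2) = 1 / (2 * γ) * (γ ^ 2 * ‖g‖ ^ 2)
        + 1 / (2 * γ) * s ^ 2 * ‖g‖ ^ 2 - s * ‖g‖ ^ 2 := by
      field_simp; ring
    rw [e5] at h2
    have h5 : (s * ‖g‖) * (‖g‖ - (M + s * ((δ / 2 + 1 / (2 * γ)) * ‖g‖))) ≤ 0 := by
      nlinarith [mul_le_mul_of_nonneg_left h3 hs.le]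
    have := nonpos_of_mul_nonpos_right h5 (by positivity)
    linarith
  refine le_of_forall_pos_le_add fun c hc => ?_
  have hK : 0 < (δ / 2 + 1 / (2 * γ)) * ‖g‖ := by
    have := h.δ_nonneg
    positivity
  have := key (c / ((δ / 2 + 1 / (2 * γ)) * ‖g‖)) (by positivity)
  rwa [div_mul_cancel₀ _ hK.ne'] at this

/-- Strong monotonicity of the regularized saddle operator at its zero. -/
theorem monotone_le (h : MinMaxProblem Y φ gradY γ δ μ L M) (x u : Vec dx) {y : Vec dy}
    (hy : y ∈ Y) {v : Vec dx} (hv : v ∈ subdifferential (fun u => φ u y) u) :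
    (1 / γ - δ) * ‖u - prox γ (maxVal Y φ) x‖ ^ 2
        + μ * ‖y - argmaxOn Y (φ (prox γ (maxVal Y φ) x))‖ ^ 2
      ≤ inner ℝ (u - prox γ (maxVal Y φ) x) (v + (1 / γ) • (u - x))
        - inner ℝ (y - argmaxOn Y (φ (prox γ (maxVal Y φ) x))) (gradY u y) := by
  -- Adding `h1`–`h4` cancels the values of φ at the four corners (p, z), (u, z), (u, y), (p, y);
  -- only quadratic and inner product terms remain.
  have h1 := h.saddle_le x u
  set p := prox γ (maxVal Y φ) x
  set z := argmaxOn Y (φ p)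
  have h2 := (h.weaklyConvex y hy).le_of_mem_subdifferential hv p
  have h3 := h.le_gradient u hy (h.argmax_mem p)
  have h4 := h.le_argmax_sub p hy
  have e3 : 1 / γ = 2 * (1 / (2 * γ)) := by have := h.γ_pos; field_simp
  have e : ‖p - x‖ ^ 2 = ‖u - x‖ ^ 2 - 2 * inner ℝ (u - p) (u - x) + ‖u - p‖ ^ 2 := by
    have : p - x = (u - x) - (u - p) := by abel
    rw [this, norm_sub_sq_real, real_inner_comm]
  rw [e] at h1
  rw [← neg_sub u p, norm_neg, inner_neg_right, real_inner_comm] at h2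
  rw [← neg_sub y z, norm_neg, inner_neg_right, real_inner_comm] at h3
  rw [inner_add_right, real_inner_smul_right, e3]
  rw [e3] at h1
  linarith

end MinMaxProblem

/-! ### Moments and integration over an independent sample -/

section Moments

variable {Ω : Type*} [MeasurableSpace Ω] {P : Measure Ω} [IsProbabilityMeasure P]

/-- Integrate the pointwise bound ‖f‖ ≤ ‖f‖² / (2a) + a/2. -/
theorem integral_norm_le_of_integral_sq_le {E : Type*} [NormedAddCommGroup E] {f : Ω → E} {a : ℝ}
    (ha : 0 < a) (hf : Integrable f P) (hf2 : Integrable (fun ω => ‖f ω‖ ^ 2) P)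
    (h : ∫ ω, ‖f ω‖ ^ 2 ∂P ≤ a ^ 2) : ∫ ω, ‖f ω‖ ∂P ≤ a := by
  have h1 : ∀ ω, ‖f ω‖ ≤ 1 / (2 * a) * ‖f ω‖ ^ 2 + a / 2 := by
    intro ω
    have e : 1 / (2 * a) * ‖f ω‖ ^ 2 + a / 2 - ‖f ω‖ = 1 / (2 * a) * (‖f ω‖ - a) ^ 2 := by
      field_simp; ring
    have : 0 ≤ 1 / (2 * a) * (‖f ω‖ - a) ^ 2 := by positivity
    linarith
  have h2 := integral_mono hf.norm ((hf2.const_mul (1 / (2 * a))).add (integrable_const (a / 2))) h1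
  simp only [Pi.add_apply] at h2
  rw [integral_add (hf2.const_mul _) (integrable_const _), integral_const_mul, integral_const,
    probReal_univ, one_smul] at h2
  have h3 : 1 / (2 * a) * ∫ ω, ‖f ω‖ ^ 2 ∂P ≤ 1 / (2 * a) * a ^ 2 := by gcongr
  have e : 1 / (2 * a) * a ^ 2 = a / 2 := by field_simp
  linarith

/-- This replaces conditioning on the past: the joint law of (Z, ξ) is a product, so Tonelli
integrates ξ out first. Working with nonnegative functions gives integrability of the composite
together with the bound. -/
theorem integral_comp_le_of_indepFun {E S : Type*} [MeasurableSpace E] [MeasurableSpace S]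
    {D : Measure S} [IsProbabilityMeasure D] {Z : Ω → E} {ξ : Ω → S} (hZ : Measurable Z)
    (hξ : Measurable ξ) (hlaw : P.map ξ = D) (hind : IndepFun Z ξ P) {f : E → S → ℝ}
    (hf : Measurable fun q : E × S => f q.1 q.2) (hf0 : ∀ z s, 0 ≤ f z s) {g : Ω → ℝ}
    (hg : Integrable g P) (hfi : ∀ ω, Integrable (f (Z ω)) D)
    (hfg : ∀ ω, ∫ s, f (Z ω) s ∂D ≤ g ω) :
    Integrable (fun ω => f (Z ω) (ξ ω)) P ∧ ∫ ω, f (Z ω) (ξ ω) ∂P ≤ ∫ ω, g ω ∂P := by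
  have hm : Measurable fun ω => f (Z ω) (ξ ω) := hf.comp (hZ.prodMk hξ)
  have hg0 : ∀ ω, 0 ≤ g ω := fun ω => (integral_nonneg (hf0 (Z ω))).trans (hfg ω)
  have hF : Measurable fun q : E × S => ENNReal.ofReal (f q.1 q.2) := hf.ennreal_ofReal
  have key : ∫⁻ ω, ENNReal.ofReal (f (Z ω) (ξ ω)) ∂P ≤ ENNReal.ofReal (∫ ω, g ω ∂P) := by
    have h1 : ∫⁻ ω, ENNReal.ofReal (f (Z ω) (ξ ω)) ∂P
        = ∫⁻ q, ENNReal.ofReal (f q.1 q.2) ∂(P.map fun ω => (Z ω, ξ ω)) :=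
      (lintegral_map hF (hZ.prodMk hξ)).symm
    have : IsProbabilityMeasure (P.map Z) := Measure.isProbabilityMeasure_map hZ.aemeasurable
    rw [h1, hind.map_prod_eq_prod_map_map hZ.aemeasurable hξ.aemeasurable, hlaw,
      lintegral_prod _ hF.aemeasurable, lintegral_map hF.lintegral_prod_right' hZ,
      ofReal_integral_eq_lintegral_ofReal hg (Eventually.of_forall hg0)]
    refine lintegral_mono fun ω => ?_
    simp only
    rw [← ofReal_integral_eq_lintegral_ofReal (hfi ω) (Eventually.of_forall (hf0 _))]
    exact ENNReal.ofReal_le_ofReal (hfg ω)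
  have hint : Integrable (fun ω => f (Z ω) (ξ ω)) P := by
    refine ⟨hm.aestronglyMeasurable, ?_⟩
    rw [hasFiniteIntegral_iff_ofReal (Eventually.of_forall fun ω => hf0 _ _)]
    exact key.trans_lt ENNReal.ofReal_lt_top
  refine ⟨hint, ?_⟩
  rwa [← ofReal_integral_eq_lintegral_ofReal hint (Eventually.of_forall fun ω => hf0 _ _),
    ENNReal.ofReal_le_ofReal_iff (integral_nonneg hg0)] at key

end Moments

theorem ProblemAssumption.minMaxProblem {dx dy : ℕ} {Y : Set (Vec dy)} {φ : Vec dx → Vec dy → ℝ}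
    {gradY : Vec dx → Vec dy → Vec dy} {γ δ μ L Fstar M : ℝ}
    {S : Type*} [MeasurableSpace S] {D : Measure S} [IsProbabilityMeasure D]
    {gx : Vec dx → Vec dy → S → Vec dx} {gy : Vec dx → Vec dy → S → Vec dy}
    (hp : ProblemAssumption Y φ gradY γ δ μ L Fstar)
    (ho : OracleAssumption D Y φ gradY gx gy M) (hY : IsClosed Y) (hYc : Convex ℝ Y)
    (hne : Y.Nonempty) (hγ : 0 < γ) (hδ : 0 ≤ δ) (hγδ : γ * δ < 1) (hμ : 0 < μ) (hM : 0 < M) :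
    MinMaxProblem Y φ gradY γ δ μ L M where
  closed := hY
  convex := hYc
  nonempty := hne
  γ_pos := hγ
  δ_nonneg := hδ
  γδ_lt := hγδ
  μ_pos := hμ
  weaklyConvex := hp.weaklyConvex
  stronglyConcave := hp.stronglyConcave
  hasGradient := hp.hasGradient
  lipschitz := hp.lipschitz
  exists_subgradient x y hy := by
    -- The bounded subgradient is the mean of the oracle.
    refine ⟨_, ho.unbiased_gx x y hy, (norm_integral_le_integral_norm _).trans ?_⟩
    have h := ho.memLp_gx x y hy
    exact integral_norm_le_of_integral_sq_le hM (h.integrable one_le_two)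
      (h.integrable_norm_pow two_ne_zero) (ho.bound_gx x y hy)

/-! ### One stochastic descent-ascent step from a fixed state -/

section Step

variable {dx dy : ℕ} {Y : Set (Vec dy)} {φ : Vec dx → Vec dy → ℝ}
  {gradY : Vec dx → Vec dy → Vec dy} {γ δ μ L M : ℝ}
  {S : Type*} [MeasurableSpace S] {D : Measure S} [IsProbabilityMeasure D]
  {gx : Vec dx → Vec dy → S → Vec dx} {gy : Vec dx → Vec dy → S → Vec dy}

/-- In the expanded squares the cross terms average to the saddle operator and are handled by
`monotone_le`. With (x_φ - x)/γ = u/γ - ∇F_γ(x), the quadratic terms cost 4M² + 4M² in x and M² in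
y, whence 9; the leftover 2η²‖u‖²/γ² uses up half of the contraction 2η(1/γ - δ), by the bound on η.
-/
theorem MinMaxProblem.integral_step_le (h : MinMaxProblem Y φ gradY γ δ μ L M)
    (ho : OracleAssumption D Y φ gradY gx gy M) {η₀ η : ℝ} (hη : 0 < η)
    (hηρ : η ≤ γ ^ 2 * (1 / γ - δ) / 2) (z : State dx dy) (hz : z.y ∈ Y)
    (hm : Measurable fun s => ‖(step Y gx gy γ η₀ η s z).xφ - prox γ (maxVal Y φ) z.x‖ ^ 2
        + ‖(step Y gx gy γ η₀ η s z).y - argmaxOn Y (φ (prox γ (maxVal Y φ) z.x))‖ ^ 2) :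
    Integrable (fun s => ‖(step Y gx gy γ η₀ η s z).xφ - prox γ (maxVal Y φ) z.x‖ ^ 2
        + ‖(step Y gx gy γ η₀ η s z).y - argmaxOn Y (φ (prox γ (maxVal Y φ) z.x))‖ ^ 2) D ∧
      ∫ s, (‖(step Y gx gy γ η₀ η s z).xφ - prox γ (maxVal Y φ) z.x‖ ^ 2
        + ‖(step Y gx gy γ η₀ η s z).y - argmaxOn Y (φ (prox γ (maxVal Y φ) z.x))‖ ^ 2) ∂D
      ≤ (1 - η * (1 / γ - δ)) * ‖z.xφ - prox γ (maxVal Y φ) z.x‖ ^ 2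
        + (1 - 2 * (η * μ)) * ‖z.y - argmaxOn Y (φ (prox γ (maxVal Y φ) z.x))‖ ^ 2
        + 9 * η ^ 2 * M ^ 2 := by
  have hγ := h.γ_pos
  have hmono := h.monotone_le z.x z.xφ hz (ho.unbiased_gx z.xφ z.y hz)
  have hgM := h.norm_gradient_moreau_le z.x
  have hg := h.gradient_moreau z.x
  set p := prox γ (maxVal Y φ) z.x with hp
  set ys := argmaxOn Y (φ p) with hys
  have hysm : ys ∈ Y := h.argmax_mem p
  set r := gradient (moreau γ (maxVal Y φ)) z.x
  set u := z.xφ - p with hu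
  set w := z.y - ys with hw
  have e1 : (1 / γ) • (z.xφ - z.x) = (1 / γ) • u - r := by
    rw [hg, hu]; module
  have hpx : ∀ s, ‖(step Y gx gy γ η₀ η s z).xφ - p‖ ^ 2 ≤ ‖u‖ ^ 2
      - 2 * η * (inner ℝ u (gx z.xφ z.y s) + inner ℝ u ((1 / γ) • u - r))
      + η ^ 2 * (4 * ‖gx z.xφ z.y s‖ ^ 2 + 4 * M ^ 2 + 2 / γ ^ 2 * ‖u‖ ^ 2) := by
    intro s
    set g := gx z.xφ z.y s
    have e2 : (step Y gx gy γ η₀ η s z).xφ - p = u - η • (g + ((1 / γ) • u - r)) := by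
      simp only [step]
      rw [e1, hu]; abel
    have e3 : ‖g + ((1 / γ) • u - r)‖ ^ 2 ≤ 4 * ‖g‖ ^ 2 + 4 * M ^ 2 + 2 / γ ^ 2 * ‖u‖ ^ 2 := by
      have t1 : g + ((1 / γ) • u - r) = (g - r) + (1 / γ) • u := by abel
      have t2 := norm_add_le (g - r) ((1 / γ) • u)
      have t3 := norm_sub_le g r
      rw [← t1, norm_smul, Real.norm_of_nonneg (by positivity)] at t2
      have t4 : ‖g + ((1 / γ) • u - r)‖ ≤ (‖g‖ + M) + 1 / γ * ‖u‖ := by linarith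
      have t5 : 2 / γ ^ 2 * ‖u‖ ^ 2 = 2 * (1 / γ * ‖u‖) ^ 2 := by field_simp
      rw [t5]
      have := pow_le_pow_left₀ (norm_nonneg _) t4 2
      nlinarith [sq_nonneg (‖g‖ + M - 1 / γ * ‖u‖), sq_nonneg (‖g‖ - M)]
    rw [e2, norm_sub_sq_real, real_inner_smul_right, norm_smul, mul_pow, inner_add_right,
      Real.norm_eq_abs, sq_abs]
    have := mul_le_mul_of_nonneg_left e3 (sq_nonneg η)
    linarith
  have hpy : ∀ s, ‖(step Y gx gy γ η₀ η s z).y - ys‖ ^ 2 ≤ ‖w‖ ^ 2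
      + 2 * η * inner ℝ w (gy z.xφ z.y s) + η ^ 2 * ‖gy z.xφ z.y s‖ ^ 2 := by
    intro s
    have t1 := norm_proj_sub_le h.closed h.convex (z.y + η • gy z.xφ z.y s) hysm
    have t2 : z.y + η • gy z.xφ z.y s - ys = w + η • gy z.xφ z.y s := by rw [hw]; abel
    rw [t2] at t1
    have t3 := pow_le_pow_left₀ (norm_nonneg _) t1 2
    rw [norm_add_sq_real, real_inner_smul_right, norm_smul, mul_pow, Real.norm_eq_abs, sq_abs] at t3
    simp only [step]
    linarith
  have i1 := (ho.memLp_gx z.xφ z.y hz).integrable one_le_two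
  have i2 := (ho.memLp_gy z.xφ z.y hz).integrable one_le_two
  have i3 := (ho.memLp_gx z.xφ z.y hz).integrable_norm_pow two_ne_zero
  have i4 := (ho.memLp_gy z.xφ z.y hz).integrable_norm_pow two_ne_zero
  set K := ‖u‖ ^ 2 - 2 * η * inner ℝ u ((1 / γ) • u - r)
    + η ^ 2 * (4 * M ^ 2 + 2 / γ ^ 2 * ‖u‖ ^ 2) + ‖w‖ ^ 2 with hK
  set B : S → ℝ := fun s => K + (-2 * η) * inner ℝ u (gx z.xφ z.y s)
    + (4 * η ^ 2) * ‖gx z.xφ z.y s‖ ^ 2 + (2 * η) * inner ℝ w (gy z.xφ z.y s)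
    + η ^ 2 * ‖gy z.xφ z.y s‖ ^ 2 with hB
  have j1 : Integrable (fun s => (-2 * η) * inner ℝ u (gx z.xφ z.y s)) D :=
    (i1.const_inner u).const_mul _
  have j2 : Integrable (fun s => (2 * η) * inner ℝ w (gy z.xφ z.y s)) D :=
    (i2.const_inner w).const_mul _
  have j3 := i3.const_mul (4 * η ^ 2)
  have j4 := i4.const_mul (η ^ 2)
  have jK : Integrable (fun _ : S => K) D := integrable_const _
  have a1 : Integrable (fun s => K + (-2 * η) * inner ℝ u (gx z.xφ z.y s)) D := jK.add j1
  have a2 : Integrable (fun s => K + (-2 * η) * inner ℝ u (gx z.xφ z.y s)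
    + (4 * η ^ 2) * ‖gx z.xφ z.y s‖ ^ 2) D := a1.add j3
  have a3 : Integrable (fun s => K + (-2 * η) * inner ℝ u (gx z.xφ z.y s)
    + (4 * η ^ 2) * ‖gx z.xφ z.y s‖ ^ 2 + (2 * η) * inner ℝ w (gy z.xφ z.y s)) D := a2.add j2
  have hBi : Integrable B D := a3.add j4
  have hle : ∀ s, ‖(step Y gx gy γ η₀ η s z).xφ - p‖ ^ 2 + ‖(step Y gx gy γ η₀ η s z).y - ys‖ ^ 2
      ≤ B s := by
    intro s
    have := hpx s
    have := hpy s
    simp only [hB, hK]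
    linarith
  have hint : Integrable (fun s => ‖(step Y gx gy γ η₀ η s z).xφ - p‖ ^ 2
      + ‖(step Y gx gy γ η₀ η s z).y - ys‖ ^ 2) D := by
    refine hBi.mono' hm.aestronglyMeasurable (Eventually.of_forall fun s => ?_)
    rw [Real.norm_of_nonneg (by positivity)]
    exact hle s
  refine ⟨hint, (integral_mono hint hBi hle).trans ?_⟩
  have hBint : ∫ s, B s ∂D = K + (-2 * η) * inner ℝ u (∫ s, gx z.xφ z.y s ∂D)
    + (4 * η ^ 2) * ∫ s, ‖gx z.xφ z.y s‖ ^ 2 ∂D + (2 * η) * inner ℝ w (gradY z.xφ z.y)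
    + η ^ 2 * ∫ s, ‖gy z.xφ z.y s‖ ^ 2 ∂D := by
    simp only [hB]
    rw [integral_add a3 j4, integral_add a2 j2, integral_add a1 j3, integral_add jK j1, integral_const, probReal_univ, one_smul,
      integral_const_mul, integral_const_mul, integral_const_mul, integral_const_mul,
      integral_inner i1, integral_inner i2, ho.unbiased_gy _ _ hz]
  rw [hBint]
  have b1 := mul_le_mul_of_nonneg_left (ho.bound_gx z.xφ z.y hz) (by positivity : 0 ≤ 4 * η ^ 2)
  have b2 := mul_le_mul_of_nonneg_left (ho.bound_gy z.xφ z.y hz) (by positivity : 0 ≤ η ^ 2)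
  rw [e1, inner_add_right] at hmono
  have b3 := mul_le_mul_of_nonneg_left hmono (by positivity : 0 ≤ 2 * η)
  have b4 : η ^ 2 * (2 / γ ^ 2 * ‖u‖ ^ 2) ≤ η * (1 / γ - δ) * ‖u‖ ^ 2 := by
    have : η * (2 / γ ^ 2) ≤ 1 / γ - δ := by
      rw [mul_div_assoc', div_le_iff₀ (by positivity)]
      linarith
    have := mul_le_mul_of_nonneg_left this hη.le
    have := mul_le_mul_of_nonneg_right this (sq_nonneg ‖u‖)
    linarith
  simp only [hK]
  linarith

end Step

/-! ### Measurability and independence of the iterates -/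

section Measurability

variable {dx dy : ℕ} {Y : Set (Vec dy)} {S : Type*} [MeasurableSpace S]
  {gx : Vec dx → Vec dy → S → Vec dx} {gy : Vec dx → Vec dy → S → Vec dy}

instance : MeasurableSpace (State dx dy) :=
  MeasurableSpace.comap (fun z => (z.xφ, z.y, z.x)) inferInstance

theorem measurable_state_components :
    Measurable fun z : State dx dy => (z.xφ, z.y, z.x) := comap_measurable _

@[fun_prop]
theorem measurable_xφ : Measurable (State.xφ : State dx dy → Vec dx) :=
  measurable_fst.comp measurable_state_components

@[fun_prop]
theorem measurable_y : Measurable (State.y : State dx dy → Vec dy) :=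
  (measurable_fst.comp measurable_snd).comp measurable_state_components

@[fun_prop]
theorem measurable_x : Measurable (State.x : State dx dy → Vec dx) :=
  (measurable_snd.comp measurable_snd).comp measurable_state_components

theorem measurable_step (hY : IsClosed Y) (hYc : Convex ℝ Y) (hne : Y.Nonempty)
    (hgx : Measurable fun q : Vec dx × Vec dy × S => gx q.1 q.2.1 q.2.2)
    (hgy : Measurable fun q : Vec dx × Vec dy × S => gy q.1 q.2.1 q.2.2) (γ η₀ η₁ : ℝ) :
    Measurable fun q : State dx dy × S => step Y gx gy γ η₀ η₁ q.2 q.1 := by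
  have m : Measurable fun q : State dx dy × S => (q.1.xφ, q.1.y, q.2) := by fun_prop
  have m1 : Measurable fun q : State dx dy × S => gx q.1.xφ q.1.y q.2 := hgx.comp m
  have m2 : Measurable fun q : State dx dy × S => gy q.1.xφ q.1.y q.2 := hgy.comp m
  have m3 : Measurable (proj Y) := (continuous_proj hY hYc hne).measurable
  refine measurable_comap_iff.2 ?_
  have m4 : Measurable fun q : State dx dy × S =>
      q.1.xφ - η₁ • (gx q.1.xφ q.1.y q.2 + (1 / γ) • (q.1.xφ - q.1.x)) := by fun_prop
  refine m4.prodMk (Measurable.prodMk ?_ ?_)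
  · exact m3.comp (by fun_prop)
  · exact (measurable_x.comp measurable_fst).sub
      ((((measurable_x.comp measurable_fst).sub m4).const_smul (1 / γ)).const_smul η₀)

theorem measurable_iterate (hY : IsClosed Y) (hYc : Convex ℝ Y) (hne : Y.Nonempty)
    (hgx : Measurable fun q : Vec dx × Vec dy × S => gx q.1 q.2.1 q.2.2)
    (hgy : Measurable fun q : Vec dx × Vec dy × S => gy q.1 q.2.1 q.2.2) (γ η₀ η₁ : ℝ)
    (z₀ : State dx dy) {Ω : Type*} [MeasurableSpace Ω] (ξ : ℕ → Ω → S) (t : ℕ)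
    (hξ : ∀ k < t, Measurable (ξ k)) :
    Measurable fun ω => iterate Y gx gy γ η₀ η₁ z₀ (fun k => ξ k ω) t := by
  induction t with
  | zero => exact measurable_const
  | succ t ih =>
    exact (measurable_step hY hYc hne hgx hgy γ η₀ η₁).comp
      ((ih fun k hk => hξ k (hk.trans t.lt_succ_self)).prodMk (hξ t t.lt_succ_self))

theorem indepFun_iterate (hY : IsClosed Y) (hYc : Convex ℝ Y) (hne : Y.Nonempty)
    (hgx : Measurable fun q : Vec dx × Vec dy × S => gx q.1 q.2.1 q.2.2)
    (hgy : Measurable fun q : Vec dx × Vec dy × S => gy q.1 q.2.1 q.2.2) (γ η₀ η₁ : ℝ)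
    (z₀ : State dx dy) {Ω : Type*} [MeasurableSpace Ω] {P : Measure Ω} {ξ : ℕ → Ω → S}
    (hξ : ∀ k, Measurable (ξ k)) (hind : iIndepFun ξ P) (t : ℕ) :
    IndepFun (fun ω => iterate Y gx gy γ η₀ η₁ z₀ (fun k => ξ k ω) t) (ξ t) P := by
  have h1 := indep_iSup_of_disjoint (fun k => (hξ k).comap_le) hind
    (show Disjoint (Set.Iio t) {t} by simp)
  rw [IndepFun_iff_Indep]
  refine indep_of_indep_of_le_left (indep_of_indep_of_le_right h1 ?_) ?_
  · exact le_iSup₂_of_le t rfl le_rfl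
  · refine Measurable.comap_le (m₁ := ⨆ i ∈ Set.Iio t, MeasurableSpace.comap (ξ i) inferInstance) ?_
    -- The lemma is applied with the σ-algebra generated by the samples before time t as the
    -- measurable structure on Ω, which is why it only asks for measurability of those samples.
    refine @measurable_iterate _ _ _ _ _ _ _ hY hYc hne hgx hgy γ η₀ η₁ z₀ Ω
      (⨆ i ∈ Set.Iio t, MeasurableSpace.comap (ξ i) inferInstance) ξ t fun k hk => ?_
    exact (comap_measurable (ξ k)).mono (le_iSup₂_of_le k hk le_rfl) le_rfl

end Measurability

/-- Step sizes for which the tracking error contracts faster than the proximal point drifts. -/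
structure AdmissibleSteps (γ δ μ L α τ η : ℝ) : Prop where
  α_pos : 0 < α
  α_le_rho : α ≤ (1 / γ - δ) / 2
  α_le_mu : α ≤ μ
  τ_pos : 0 < τ
  τ_le : 4 * τ ≤ γ ^ 2 * α ^ 2
  τL_le : 16 * τ ^ 2 * L ^ 2 ≤ μ ^ 3 * γ ^ 4 * α ^ 3
  η_pos : 0 < η
  η_le : η ≤ γ ^ 2 * (1 / γ - δ) / 2
  τη_le : τ * η ≤ γ / 4

/-- The squared distance of the pair `(x_φ, y)` from the saddle point of the problem regularized
at `x`. -/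
noncomputable def trackingError {dx dy : ℕ} (Y : Set (Vec dy)) (φ : Vec dx → Vec dy → ℝ) (γ : ℝ) (x : Vec dx)
    (z : State dx dy) : ℝ :=
  ‖z.xφ - prox γ (maxVal Y φ) x‖ ^ 2 + ‖z.y - argmaxOn Y (φ (prox γ (maxVal Y φ) x))‖ ^ 2

/-- Young's inequality with weight b: since (1 - 2b)(1 + b) ≤ 1 - b and (1 - 2b)(1 + 1/b) ≤ 1/b,
half of the contraction survives a change of reference point. The case b ≥ 1/2 must be allowed, as
ημ need not be small; there the left side is nonpositive. -/
theorem contraction_sq_le {E : Type*} [NormedAddCommGroup E] {a b : ℝ} (hb : 0 < b) (hab : a ≤ b)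
    (ha : a ≤ 1) (v w w' : E) :
    (1 - 2 * b) * ‖v - w'‖ ^ 2 ≤ (1 - a) * ‖v - w‖ ^ 2 + 1 / b * ‖w - w'‖ ^ 2 := by
  have h1a : 0 ≤ 1 - a := by linarith
  rcases le_or_gt (1 / 2) b with h | h
  · have h1 : (1 - 2 * b) * ‖v - w'‖ ^ 2 ≤ 0 :=
      mul_nonpos_of_nonpos_of_nonneg (by linarith) (sq_nonneg _)
    have h2 : 0 ≤ (1 - a) * ‖v - w‖ ^ 2 + 1 / b * ‖w - w'‖ ^ 2 := by positivity
    linarith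
  · have h1 : ‖v - w'‖ ≤ ‖v - w‖ + ‖w - w'‖ := norm_sub_le_norm_sub_add_norm_sub v w w'
    have h2 := pow_le_pow_left₀ (norm_nonneg _) h1 2
    set A := ‖v - w‖
    set B := ‖w - w'‖
    have h3 : 2 * A * B ≤ b * A ^ 2 + 1 / b * B ^ 2 := by
      have e : b * A ^ 2 + 1 / b * B ^ 2 - 2 * A * B = 1 / b * (b * A - B) ^ 2 := by
        field_simp; ring
      have : 0 ≤ 1 / b * (b * A - B) ^ 2 := by positivity
      linarith
    have h4 : ‖v - w'‖ ^ 2 ≤ (1 + b) * A ^ 2 + (1 + 1 / b) * B ^ 2 := by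
      have : (A + B) ^ 2 = A ^ 2 + 2 * A * B + B ^ 2 := by ring
      linarith
    have h5 := mul_le_mul_of_nonneg_left h4 (by linarith : 0 ≤ 1 - 2 * b)
    have e : (1 - 2 * b) * ((1 + b) * A ^ 2 + (1 + 1 / b) * B ^ 2)
        = (1 - b - 2 * b ^ 2) * A ^ 2 + (1 / b - 1 - 2 * b) * B ^ 2 := by
      field_simp; ring
    rw [e] at h5
    have h6 : (1 - b - 2 * b ^ 2) * A ^ 2 ≤ (1 - a) * A ^ 2 :=
      mul_le_mul_of_nonneg_right (by nlinarith) (sq_nonneg _)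
    have h7 : (1 / b - 1 - 2 * b) * B ^ 2 ≤ 1 / b * B ^ 2 :=
      mul_le_mul_of_nonneg_right (by linarith) (sq_nonneg _)
    linarith

/-! ### Drift of the saddle point and descent of the envelope -/

section Deterministic

variable {dx dy : ℕ} {Y : Set (Vec dy)} {φ : Vec dx → Vec dy → ℝ}
  {gradY : Vec dx → Vec dy → Vec dy} {γ δ μ L M α τ η : ℝ}

theorem AdmissibleSteps.ηα_le (hs : AdmissibleSteps γ δ μ L α τ η) (hγ : 0 < γ) (hδ : 0 ≤ δ) :
    η * α ≤ 1 / 4 := by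
  have h1 : γ * (1 / γ - δ) ≤ 1 := by
    rw [mul_sub, mul_one_div_cancel hγ.ne']
    nlinarith
  have hr : 0 < 1 / γ - δ := by linarith [hs.α_pos, hs.α_le_rho]
  have h2 := mul_le_mul hs.η_le hs.α_le_rho hs.α_pos.le (by positivity)
  have h3 : (γ * (1 / γ - δ)) ^ 2 ≤ 1 := pow_le_one₀ (by positivity) h1
  linarith

theorem MinMaxProblem.norm_prox_sub_sq_le (h : MinMaxProblem Y φ gradY γ δ μ L M)
    (hα : 0 < α) (hαρ : α ≤ (1 / γ - δ) / 2) (x x' : Vec dx) :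
    4 * γ ^ 2 * α ^ 2 * ‖prox γ (maxVal Y φ) x - prox γ (maxVal Y φ) x'‖ ^ 2 ≤ ‖x - x'‖ ^ 2 := by
  have h1 := h.norm_prox_sub_le x x'
  have hγ := h.γ_pos
  set n := ‖prox γ (maxVal Y φ) x - prox γ (maxVal Y φ) x'‖ with hn
  have h2 : 2 * γ * α * n ≤ ‖x - x'‖ := by
    refine le_trans ?_ h1
    have : 2 * γ * α ≤ γ * (1 / γ - δ) := by nlinarith
    exact mul_le_mul_of_nonneg_right this (norm_nonneg _)
  have h3 := pow_le_pow_left₀ (by positivity) h2 2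
  linarith

/-- The reference point is changed with b = ηα for x_φ and b = ημ for y. The two upper bounds on τ
make each change cost at most half of the drift coefficient: one for the proximal map, of Lipschitz
constant 1/(2γα), the other for the best response, with its further factor L/μ. -/
theorem MinMaxProblem.drift_le (h : MinMaxProblem Y φ gradY γ δ μ L M)
    (hs : AdmissibleSteps γ δ μ L α τ η) (x x' : Vec dx) (z : State dx dy) :
    (1 - η * (1 / γ - δ)) * ‖z.xφ - prox γ (maxVal Y φ) x'‖ ^ 2
        + (1 - 2 * (η * μ)) * ‖z.y - argmaxOn Y (φ (prox γ (maxVal Y φ) x'))‖ ^ 2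
      ≤ (1 - η * α) * trackingError Y φ γ x z
        + α * γ ^ 2 / (32 * τ ^ 2 * η) * ‖x - x'‖ ^ 2 := by
  have hγ := h.γ_pos
  have hμ := h.μ_pos
  have ha := hs.ηα_le hγ h.δ_nonneg
  obtain ⟨hα, hαρ, hαμ, hτ, hτle, hτL, hη, -, -⟩ := hs
  have hd := h.norm_prox_sub_sq_le hα hαρ x x'
  unfold trackingError
  set p := prox γ (maxVal Y φ) x
  set p' := prox γ (maxVal Y φ) x'
  have hy := h.norm_argmax_sub_le p p'
  set y := argmaxOn Y (φ p)
  set y' := argmaxOn Y (φ p')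
  have hy2 := pow_le_pow_left₀ (by positivity) hy 2
  rw [mul_pow, mul_pow] at hy2
  have h1 := contraction_sq_le (mul_pos hη hα) le_rfl (by linarith) z.xφ p p'
  have h2 := contraction_sq_le (a := η * α) (mul_pos hη hμ)
    (mul_le_mul_of_nonneg_left hαμ hη.le) (by linarith) z.y y y'
  have h3 : (1 - η * (1 / γ - δ)) * ‖z.xφ - p'‖ ^ 2 ≤ (1 - 2 * (η * α)) * ‖z.xφ - p'‖ ^ 2 :=
    mul_le_mul_of_nonneg_right (by nlinarith) (sq_nonneg _)
  have hτ2 : 16 * τ ^ 2 ≤ γ ^ 4 * α ^ 4 := by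
    have := pow_le_pow_left₀ (by positivity) hτle 2
    linarith
  have h4 : 1 / (η * α) * ‖p - p'‖ ^ 2 ≤ α * γ ^ 2 / (64 * τ ^ 2 * η) * ‖x - x'‖ ^ 2 := by
    have : 1 / (η * α) ≤ α * γ ^ 2 / (64 * τ ^ 2 * η) * (4 * γ ^ 2 * α ^ 2) := by
      rw [div_mul_eq_mul_div, div_le_div_iff₀ (by positivity) (by positivity)]
      have := mul_le_mul_of_nonneg_left hτ2 hη.le
      linarith
    calc 1 / (η * α) * ‖p - p'‖ ^ 2
        ≤ α * γ ^ 2 / (64 * τ ^ 2 * η) * (4 * γ ^ 2 * α ^ 2) * ‖p - p'‖ ^ 2 := by gcongr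
      _ = α * γ ^ 2 / (64 * τ ^ 2 * η) * (4 * γ ^ 2 * α ^ 2 * ‖p - p'‖ ^ 2) := by ring
      _ ≤ _ := by gcongr
  have h5 : 1 / (η * μ) * ‖y - y'‖ ^ 2 ≤ α * γ ^ 2 / (64 * τ ^ 2 * η) * ‖x - x'‖ ^ 2 := by
    have e : 1 / (η * μ) * ‖y - y'‖ ^ 2 = 1 / (η * μ ^ 3) * (μ ^ 2 * ‖y - y'‖ ^ 2) := by field_simp
    have : 1 / (η * μ ^ 3) * L ^ 2 ≤ α * γ ^ 2 / (64 * τ ^ 2 * η) * (4 * γ ^ 2 * α ^ 2) := by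
      rw [div_mul_eq_mul_div, div_mul_eq_mul_div, div_le_div_iff₀ (by positivity) (by positivity)]
      have := mul_le_mul_of_nonneg_left hτL hη.le
      linarith
    calc 1 / (η * μ) * ‖y - y'‖ ^ 2 = 1 / (η * μ ^ 3) * (μ ^ 2 * ‖y - y'‖ ^ 2) := e
      _ ≤ 1 / (η * μ ^ 3) * (L ^ 2 * ‖p - p'‖ ^ 2) := by gcongr
      _ = 1 / (η * μ ^ 3) * L ^ 2 * ‖p - p'‖ ^ 2 := by ring
      _ ≤ α * γ ^ 2 / (64 * τ ^ 2 * η) * (4 * γ ^ 2 * α ^ 2) * ‖p - p'‖ ^ 2 := by gcongr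
      _ = α * γ ^ 2 / (64 * τ ^ 2 * η) * (4 * γ ^ 2 * α ^ 2 * ‖p - p'‖ ^ 2) := by ring
      _ ≤ _ := by gcongr
  have e : α * γ ^ 2 / (32 * τ ^ 2 * η) * ‖x - x'‖ ^ 2
      = 2 * (α * γ ^ 2 / (64 * τ ^ 2 * η) * ‖x - x'‖ ^ 2) := by field_simp; ring
  rw [e]
  linarith

/-- Since ∇F_γ(x) - G = (w - p)/γ, polarizing ⟪∇F_γ(x), G⟫ produces the error term and both negative
squares. The second-order term is at most η₀‖G‖²/8 because η₀ ≤ γ/4, and 1/2 - 1/8 = 3/8. -/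
theorem MinMaxProblem.moreau_descent (h : MinMaxProblem Y φ gradY γ δ μ L M) {η₀ : ℝ}
    (hη₀ : 0 < η₀) (hη₀γ : η₀ ≤ γ / 4) (x w : Vec dx) :
    moreau γ (maxVal Y φ) (x - η₀ • ((1 / γ) • (x - w)))
      ≤ moreau γ (maxVal Y φ) x + η₀ / (2 * γ ^ 2) * ‖w - prox γ (maxVal Y φ) x‖ ^ 2
        - η₀ / 2 * ‖gradient (moreau γ (maxVal Y φ)) x‖ ^ 2
        - 3 / 8 * η₀ * ‖(1 / γ) • (x - w)‖ ^ 2 := by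
  have hγ := h.γ_pos
  have h1 := h.moreau_le_add x (x - η₀ • ((1 / γ) • (x - w)))
  rw [← h.gradient_moreau] at h1
  have hg := h.gradient_moreau x
  set p := prox γ (maxVal Y φ) x
  set r := gradient (moreau γ (maxVal Y φ)) x
  set G := (1 / γ) • (x - w) with hG
  have e1 : x - η₀ • G - x = -(η₀ • G) := by abel
  have e2 : (1 / γ) • (w - p) = r - G := by rw [hg, hG]; module
  have e3 : ‖w - p‖ ^ 2 = γ ^ 2 * ‖r - G‖ ^ 2 := by
    rw [← e2, norm_smul, mul_pow, Real.norm_eq_abs, sq_abs]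
    field_simp
  rw [e1, inner_neg_right, real_inner_smul_right, norm_neg, norm_smul, mul_pow, Real.norm_eq_abs,
    sq_abs] at h1
  have e4 : η₀ / (2 * γ ^ 2) * (γ ^ 2 * ‖r - G‖ ^ 2) = η₀ / 2 * ‖r - G‖ ^ 2 := by field_simp
  rw [e3, e4, norm_sub_sq_real]
  have h2 : 1 / (2 * γ) * (η₀ ^ 2 * ‖G‖ ^ 2) ≤ η₀ / 8 * ‖G‖ ^ 2 := by
    have : 1 / (2 * γ) * η₀ ^ 2 ≤ η₀ / 8 := by
      rw [one_div_mul_eq_div, div_le_div_iff₀ (by positivity) (by norm_num)]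
      nlinarith
    rw [← mul_assoc]
    exact mul_le_mul_of_nonneg_right this (sq_nonneg _)
  linarith

end Deterministic

/-! ### Expected tracking error and potential along the run -/

section Trajectory

variable {dx dy : ℕ} {Y : Set (Vec dy)} {φ : Vec dx → Vec dy → ℝ}
  {gradY : Vec dx → Vec dy → Vec dy} {γ δ μ L M α τ η : ℝ}
  {S : Type*} [MeasurableSpace S] {D : Measure S} [IsProbabilityMeasure D]
  {gx : Vec dx → Vec dy → S → Vec dx} {gy : Vec dx → Vec dy → S → Vec dy}
  {Ω : Type*} [MeasurableSpace Ω] {P : Measure Ω} [IsProbabilityMeasure P]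
  {ξ : ℕ → Ω → S} {z₀ : State dx dy}

omit [MeasurableSpace S] in
theorem iterate_y_mem (hY : IsClosed Y) (hne : Y.Nonempty) {η₀ η : ℝ} (hy₀ : z₀.y ∈ Y) (s : ℕ → S)
    (t : ℕ) : (iterate Y gx gy γ η₀ η z₀ s t).y ∈ Y := by
  cases t with
  | zero => exact hy₀
  | succ t => exact (proj_spec hY hne _).1

omit [IsProbabilityMeasure D] in
theorem MinMaxProblem.measurable_iterate (h : MinMaxProblem Y φ gradY γ δ μ L M)
    (ho : OracleAssumption D Y φ gradY gx gy M) (hξ : ∀ k, Measurable (ξ k)) (η₀ η : ℝ) (t : ℕ) :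
    Measurable fun ω => iterate Y gx gy γ η₀ η z₀ (fun k => ξ k ω) t :=
  SMAG.measurable_iterate h.closed h.convex h.nonempty ho.measurable_gx ho.measurable_gy γ η₀ η z₀ ξ
    t fun k _ => hξ k

theorem MinMaxProblem.measurable_trackingError (h : MinMaxProblem Y φ gradY γ δ μ L M)
    {A : Type*} [MeasurableSpace A] {X : A → Vec dx} {Z : A → State dx dy} (hX : Measurable X)
    (hZ : Measurable Z) : Measurable fun a => trackingError Y φ γ (X a) (Z a) := by
  have m1 : Measurable fun a => prox γ (maxVal Y φ) (X a) :=
    h.continuous_prox.measurable.comp hX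
  have m2 : Measurable fun a => argmaxOn Y (φ (prox γ (maxVal Y φ) (X a))) :=
    h.continuous_argmax.measurable.comp m1
  exact (((measurable_xφ.comp hZ).sub m1).norm.pow_const 2).add
    (((measurable_y.comp hZ).sub m2).norm.pow_const 2)

theorem trackingError_nonneg (x : Vec dx) (z : State dx dy) : 0 ≤ trackingError Y φ γ x z := by
  unfold trackingError; positivity

theorem MinMaxProblem.integral_trackingError_step_le (h : MinMaxProblem Y φ gradY γ δ μ L M)
    (ho : OracleAssumption D Y φ gradY gx gy M) {Z : Ω → State dx dy} {ζ : Ω → S}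
    (hZ : Measurable Z) (hζ : Measurable ζ) (hlaw : P.map ζ = D) (hind : IndepFun Z ζ P)
    (hZy : ∀ ω, (Z ω).y ∈ Y) {η₀ : ℝ} (hη : 0 < η) (hηρ : η ≤ γ ^ 2 * (1 / γ - δ) / 2)
    {g : Ω → ℝ} (hg : Integrable g P)
    (hle : ∀ ω, (1 - η * (1 / γ - δ)) * ‖(Z ω).xφ - prox γ (maxVal Y φ) (Z ω).x‖ ^ 2
        + (1 - 2 * (η * μ)) * ‖(Z ω).y - argmaxOn Y (φ (prox γ (maxVal Y φ) (Z ω).x))‖ ^ 2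
          ≤ g ω) :
    Integrable (fun ω => trackingError Y φ γ (Z ω).x (step Y gx gy γ η₀ η (ζ ω) (Z ω))) P ∧
      ∫ ω, trackingError Y φ γ (Z ω).x (step Y gx gy γ η₀ η (ζ ω) (Z ω)) ∂P
      ≤ ∫ ω, g ω ∂P + 9 * η ^ 2 * M ^ 2 := by
  have hstep := measurable_step h.closed h.convex h.nonempty ho.measurable_gx ho.measurable_gy γ η₀ η
  have hx : Measurable fun q : State dx dy × S => q.1.x := measurable_x.comp measurable_fst
  have hm : Measurable fun q : State dx dy × S =>
      trackingError Y φ γ q.1.x (step Y gx gy γ η₀ η q.2 q.1) :=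
    by
    have := h.measurable_trackingError hx hstep
    exact this
  have hm' : ∀ z : State dx dy, Measurable fun s =>
      trackingError Y φ γ z.x (step Y gx gy γ η₀ η s z) := fun z => by
    have := hm.comp (measurable_prodMk_left (x := z))
    exact this
  have hone : ∀ ω, Integrable (fun s => trackingError Y φ γ (Z ω).x (step Y gx gy γ η₀ η s (Z ω))) D ∧
      ∫ s, trackingError Y φ γ (Z ω).x (step Y gx gy γ η₀ η s (Z ω)) ∂D
        ≤ g ω + 9 * η ^ 2 * M ^ 2 := fun ω => by
    have := h.integral_step_le ho (η₀ := η₀) hη hηρ (Z ω) (hZy ω) (hm' (Z ω))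
    exact ⟨this.1, this.2.trans (by linarith [hle ω])⟩
  have hg' : Integrable (fun ω => g ω + 9 * η ^ 2 * M ^ 2) P := hg.add (integrable_const _)
  have key := integral_comp_le_of_indepFun
    (f := fun z s => trackingError Y φ γ z.x (step Y gx gy γ η₀ η s z)) hZ hζ hlaw hind hm
    (fun _ _ => trackingError_nonneg _ _) hg' (fun ω => (hone ω).1) (fun ω => (hone ω).2)
  rw [integral_add hg (integrable_const _), integral_const, probReal_univ, one_smul] at key
  exact key

/-- The expected tracking error after a step, given a bound for the error before the step. -/
theorem MinMaxProblem.integral_trackingError_le (h : MinMaxProblem Y φ gradY γ δ μ L M)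
    (ho : OracleAssumption D Y φ gradY gx gy M) (hξ : ∀ k, Measurable (ξ k))
    (hlaw : ∀ k, P.map (ξ k) = D) (hind : iIndepFun ξ P) (hy₀ : z₀.y ∈ Y) {η₀ : ℝ} (hη : 0 < η)
    (hηρ : η ≤ γ ^ 2 * (1 / γ - δ) / 2) (t : ℕ) {g : Ω → ℝ} (hg : Integrable g P)
    (hle : ∀ ω, (1 - η * (1 / γ - δ)) * ‖(iterate Y gx gy γ η₀ η z₀ (fun k => ξ k ω) t).xφ
          - prox γ (maxVal Y φ) (iterate Y gx gy γ η₀ η z₀ (fun k => ξ k ω) t).x‖ ^ 2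
        + (1 - 2 * (η * μ)) * ‖(iterate Y gx gy γ η₀ η z₀ (fun k => ξ k ω) t).y
          - argmaxOn Y (φ (prox γ (maxVal Y φ)
              (iterate Y gx gy γ η₀ η z₀ (fun k => ξ k ω) t).x))‖ ^ 2 ≤ g ω) :
    Integrable (fun ω => trackingError Y φ γ (iterate Y gx gy γ η₀ η z₀ (fun k => ξ k ω) t).x
        (iterate Y gx gy γ η₀ η z₀ (fun k => ξ k ω) (t + 1))) P ∧
      ∫ ω, trackingError Y φ γ (iterate Y gx gy γ η₀ η z₀ (fun k => ξ k ω) t).x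
        (iterate Y gx gy γ η₀ η z₀ (fun k => ξ k ω) (t + 1)) ∂P
      ≤ ∫ ω, g ω ∂P + 9 * η ^ 2 * M ^ 2 :=
  h.integral_trackingError_step_le ho (h.measurable_iterate ho hξ η₀ η t) (hξ t) (hlaw t)
    (indepFun_iterate h.closed h.convex h.nonempty ho.measurable_gx ho.measurable_gy γ η₀ η z₀ hξ
      hind t) (fun _ => iterate_y_mem h.closed h.nonempty hy₀ _ t) hη hηρ hg hle

theorem MinMaxProblem.integrable_gradient_sq (h : MinMaxProblem Y φ gradY γ δ μ L M) {X : Ω → Vec dx}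
    (hX : Measurable X) :
    Integrable (fun ω => ‖gradient (moreau γ (maxVal Y φ)) (X ω)‖ ^ 2) P := by
  refine Integrable.of_bound
    (((h.continuous_gradient_moreau.norm.pow 2).measurable.comp hX).aestronglyMeasurable) (M ^ 2)
    (Eventually.of_forall fun ω => ?_)
  rw [Real.norm_of_nonneg (by positivity)]
  exact pow_le_pow_left₀ (norm_nonneg _) (h.norm_gradient_moreau_le _) 2

/-- The displacement is the bounded vector ∇F_γ(X) minus (x_φ - p)/γ, which the tracking error
controls. -/
theorem MinMaxProblem.integrable_displacement_sq (h : MinMaxProblem Y φ gradY γ δ μ L M)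
    {X : Ω → Vec dx} {Z : Ω → State dx dy} (hX : Measurable X) (hZ : Measurable Z)
    (hi : Integrable (fun ω => trackingError Y φ γ (X ω) (Z ω)) P) :
    Integrable (fun ω => ‖(1 / γ) • (X ω - (Z ω).xφ)‖ ^ 2) P := by
  have hγ := h.γ_pos
  have hg := h.integrable_gradient_sq (P := P) hX
  refine ((hg.const_mul 2).add (hi.const_mul (2 / γ ^ 2))).mono' ?_ (Eventually.of_forall fun ω => ?_)
  · have : Measurable fun ω => ‖(1 / γ) • (X ω - (Z ω).xφ)‖ ^ 2 := by fun_prop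
    exact this.aestronglyMeasurable
  · rw [Real.norm_of_nonneg (by positivity)]
    simp only [Pi.add_apply]
    have hgr := h.gradient_moreau (X ω)
    set r := gradient (moreau γ (maxVal Y φ)) (X ω)
    set p := prox γ (maxVal Y φ) (X ω) with hp
    have e : (1 / γ) • (X ω - (Z ω).xφ) = r - (1 / γ) • ((Z ω).xφ - p) := by rw [hgr]; module
    have h1 := norm_sub_le r ((1 / γ) • ((Z ω).xφ - p))
    rw [← e, norm_smul (1 / γ) ((Z ω).xφ - p), Real.norm_of_nonneg (by positivity)] at h1
    have h2 := pow_le_pow_left₀ (norm_nonneg _) h1 2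
    have h3 : ‖(Z ω).xφ - p‖ ^ 2 ≤ trackingError Y φ γ (X ω) (Z ω) := by
      unfold trackingError
      rw [← hp]
      linarith [sq_nonneg ‖(Z ω).y - argmaxOn Y (φ p)‖]
    have h4 : 2 / γ ^ 2 * ‖(Z ω).xφ - p‖ ^ 2 ≤ 2 / γ ^ 2 * trackingError Y φ γ (X ω) (Z ω) := by
      gcongr
    have h5 : 2 / γ ^ 2 * ‖(Z ω).xφ - p‖ ^ 2 = 2 * (1 / γ * ‖(Z ω).xφ - p‖) ^ 2 := by field_simp
    nlinarith [sq_nonneg (‖r‖ - 1 / γ * ‖(Z ω).xφ - p‖)]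

/-- The first step involves no drift, as x₀ is the reference both before and after it. -/
theorem MinMaxProblem.trackingError_zero (h : MinMaxProblem Y φ gradY γ δ μ L M)
    (ho : OracleAssumption D Y φ gradY gx gy M) (hξ : ∀ k, Measurable (ξ k))
    (hlaw : ∀ k, P.map (ξ k) = D) (hind : iIndepFun ξ P) (hy₀ : z₀.y ∈ Y) {η₀ : ℝ} (hη : 0 < η)
    (hηρ : η ≤ γ ^ 2 * (1 / γ - δ) / 2) :
    Integrable (fun ω => trackingError Y φ γ z₀.x
        (iterate Y gx gy γ η₀ η z₀ (fun k => ξ k ω) 1)) P ∧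
      ∫ ω, trackingError Y φ γ z₀.x (iterate Y gx gy γ η₀ η z₀ (fun k => ξ k ω) 1) ∂P
      ≤ trackingError Y φ γ z₀.x z₀ + 9 * η ^ 2 * M ^ 2 := by
  have := h.integral_trackingError_le (η₀ := η₀) ho hξ hlaw hind hy₀ hη hηρ 0
    (g := fun _ => trackingError Y φ γ z₀.x z₀) (integrable_const _) (fun ω => by
      have h1 : 0 ≤ η * (1 / γ - δ) := mul_nonneg hη.le h.rho_pos.le
      have h2 : 0 ≤ η * μ := mul_nonneg hη.le h.μ_pos.le
      simp only [iterate, trackingError]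
      nlinarith [mul_nonneg h1 (sq_nonneg ‖z₀.xφ - prox γ (maxVal Y φ) z₀.x‖), mul_nonneg h2
        (sq_nonneg ‖z₀.y - argmaxOn Y (φ (prox γ (maxVal Y φ) z₀.x))‖)])
  simpa [iterate] using this

theorem MinMaxProblem.trackingError_succ (h : MinMaxProblem Y φ gradY γ δ μ L M)
    (ho : OracleAssumption D Y φ gradY gx gy M) (hξ : ∀ k, Measurable (ξ k))
    (hlaw : ∀ k, P.map (ξ k) = D) (hind : iIndepFun ξ P) (hy₀ : z₀.y ∈ Y)
    (hs : AdmissibleSteps γ δ μ L α τ η) (t : ℕ)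
    (hi : Integrable (fun ω => trackingError Y φ γ
      (iterate Y gx gy γ (τ * η) η z₀ (fun k => ξ k ω) t).x
      (iterate Y gx gy γ (τ * η) η z₀ (fun k => ξ k ω) (t + 1))) P) :
    Integrable (fun ω => trackingError Y φ γ
        (iterate Y gx gy γ (τ * η) η z₀ (fun k => ξ k ω) (t + 1)).x
        (iterate Y gx gy γ (τ * η) η z₀ (fun k => ξ k ω) (t + 2))) P ∧
      ∫ ω, trackingError Y φ γ (iterate Y gx gy γ (τ * η) η z₀ (fun k => ξ k ω) (t + 1)).x
        (iterate Y gx gy γ (τ * η) η z₀ (fun k => ξ k ω) (t + 2)) ∂P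
      ≤ (1 - η * α) * ∫ ω, trackingError Y φ γ
          (iterate Y gx gy γ (τ * η) η z₀ (fun k => ξ k ω) t).x
          (iterate Y gx gy γ (τ * η) η z₀ (fun k => ξ k ω) (t + 1)) ∂P
        + η * γ ^ 2 * α / 32 * ∫ ω, ‖(1 / γ) •
            ((iterate Y gx gy γ (τ * η) η z₀ (fun k => ξ k ω) t).x
              - (iterate Y gx gy γ (τ * η) η z₀ (fun k => ξ k ω) (t + 1)).xφ)‖ ^ 2 ∂P
        + 9 * η ^ 2 * M ^ 2 := by
  have hm := fun t => h.measurable_iterate (z₀ := z₀) ho hξ (τ * η) η t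
  have hG := h.integrable_displacement_sq (measurable_x.comp (hm t)) (hm (t + 1)) hi
  have key := h.integral_trackingError_le (η₀ := τ * η) ho hξ hlaw hind hy₀ hs.η_pos hs.η_le (t + 1)
    ((hi.const_mul (1 - η * α)).add (hG.const_mul (η * γ ^ 2 * α / 32))) (fun ω => by
      refine (h.drift_le hs (iterate Y gx gy γ (τ * η) η z₀ (fun k => ξ k ω) t).x _ _).trans
        (le_of_eq ?_)
      simp only [Pi.add_apply, Function.comp_apply]
      congr 1
      set X := iterate Y gx gy γ (τ * η) η z₀ (fun k => ξ k ω) t with hX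
      -- With x_t - x_{t+1} = τηG the drift coefficient αγ²/(32τ²η) becomes ηγ²α/32.
      have e : (iterate Y gx gy γ (τ * η) η z₀ (fun k => ξ k ω) (t + 1)).x = X.x - (τ * η) •
          ((1 / γ) • (X.x - (iterate Y gx gy γ (τ * η) η z₀ (fun k => ξ k ω) (t + 1)).xφ)) := rfl
      have hτ := hs.τ_pos
      have hη := hs.η_pos
      rw [e, sub_sub_cancel, norm_smul (τ * η), Real.norm_of_nonneg (by positivity), mul_pow]
      field_simp)
  have i1 := hi.const_mul (1 - η * α)
  have i2 := hG.const_mul (η * γ ^ 2 * α / 32)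
  rw [integral_add' i1 i2, integral_const_mul, integral_const_mul] at key
  exact key

theorem MinMaxProblem.integrable_trackingError (h : MinMaxProblem Y φ gradY γ δ μ L M)
    (ho : OracleAssumption D Y φ gradY gx gy M) (hξ : ∀ k, Measurable (ξ k))
    (hlaw : ∀ k, P.map (ξ k) = D) (hind : iIndepFun ξ P) (hy₀ : z₀.y ∈ Y)
    (hs : AdmissibleSteps γ δ μ L α τ η) (t : ℕ) :
    Integrable (fun ω => trackingError Y φ γ
      (iterate Y gx gy γ (τ * η) η z₀ (fun k => ξ k ω) t).x
      (iterate Y gx gy γ (τ * η) η z₀ (fun k => ξ k ω) (t + 1))) P := by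
  induction t with
  | zero => exact (h.trackingError_zero ho hξ hlaw hind hy₀ hs.η_pos hs.η_le).1
  | succ t ih => exact (h.trackingError_succ ho hξ hlaw hind hy₀ hs t ih).1

omit [IsProbabilityMeasure P] in
theorem MinMaxProblem.integrable_dist_prox_sq (h : MinMaxProblem Y φ gradY γ δ μ L M)
    {X : Ω → Vec dx} {Z : Ω → State dx dy} (hX : Measurable X) (hZ : Measurable Z)
    (hi : Integrable (fun ω => trackingError Y φ γ (X ω) (Z ω)) P) :
    Integrable (fun ω => ‖(Z ω).xφ - prox γ (maxVal Y φ) (X ω)‖ ^ 2) P := by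
  have m1 : Measurable (prox γ (maxVal Y φ)) := h.continuous_prox.measurable
  have m2 : Measurable fun ω => ‖(Z ω).xφ - prox γ (maxVal Y φ) (X ω)‖ ^ 2 := by fun_prop
  refine hi.mono' m2.aestronglyMeasurable (Eventually.of_forall fun ω => ?_)
  rw [Real.norm_of_nonneg (by positivity)]
  unfold trackingError
  linarith [sq_nonneg ‖(Z ω).y - argmaxOn Y (φ (prox γ (maxVal Y φ) (X ω)))‖]

theorem MinMaxProblem.continuous_moreau (h : MinMaxProblem Y φ gradY γ δ μ L M) :
    Continuous (moreau γ (maxVal Y φ)) :=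
  continuous_iff_continuousAt.2 fun x => (h.hasGradientAt_moreau x).differentiableAt.continuousAt

/-- By induction: the envelope is bounded below by `Fstar` and above, through the descent
inequality, by integrable terms. -/
theorem MinMaxProblem.integrable_moreau (h : MinMaxProblem Y φ gradY γ δ μ L M)
    (ho : OracleAssumption D Y φ gradY gx gy M) (hξ : ∀ k, Measurable (ξ k))
    (hlaw : ∀ k, P.map (ξ k) = D) (hind : iIndepFun ξ P) (hy₀ : z₀.y ∈ Y)
    (hs : AdmissibleSteps γ δ μ L α τ η) {Fstar : ℝ}
    (hF : ∀ x, Fstar ≤ moreau γ (maxVal Y φ) x) (t : ℕ) :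
    Integrable (fun ω => moreau γ (maxVal Y φ)
      (iterate Y gx gy γ (τ * η) η z₀ (fun k => ξ k ω) t).x) P := by
  have hη₀ : 0 < τ * η := mul_pos hs.τ_pos hs.η_pos
  have hm := fun t => h.measurable_iterate (z₀ := z₀) ho hξ (τ * η) η t
  induction t with
  | zero => simp [iterate]
  | succ t ih =>
    have hd := h.integrable_dist_prox_sq (measurable_x.comp (hm t)) (hm (t + 1))
      (h.integrable_trackingError ho hξ hlaw hind hy₀ hs t)
    have hi := (ih.sub (integrable_const (μ := P) Fstar)).add (hd.const_mul (τ * η / (2 * γ ^ 2)))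
    have key : Integrable (fun ω => moreau γ (maxVal Y φ)
      (iterate Y gx gy γ (τ * η) η z₀ (fun k => ξ k ω) (t + 1)).x - Fstar) P := by
      refine hi.mono' ?_ (Eventually.of_forall fun ω => ?_)
      · exact ((h.continuous_moreau.measurable.comp
          (measurable_x.comp (hm (t + 1)))).sub_const _).aestronglyMeasurable
      · rw [Real.norm_of_nonneg (by linarith [hF (iterate Y gx gy γ (τ * η) η z₀
          (fun k => ξ k ω) (t + 1)).x])]
        have := h.moreau_descent hη₀ hs.τη_le (iterate Y gx gy γ (τ * η) η z₀ (fun k => ξ k ω) t).x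
          (iterate Y gx gy γ (τ * η) η z₀ (fun k => ξ k ω) (t + 1)).xφ
        have e : (iterate Y gx gy γ (τ * η) η z₀ (fun k => ξ k ω) (t + 1)).x
          = (iterate Y gx gy γ (τ * η) η z₀ (fun k => ξ k ω) t).x - (τ * η) • ((1 / γ) •
            ((iterate Y gx gy γ (τ * η) η z₀ (fun k => ξ k ω) t).x
              - (iterate Y gx gy γ (τ * η) η z₀ (fun k => ξ k ω) (t + 1)).xφ)) := rfl
        rw [← e] at this
        simp only [Pi.add_apply, Pi.sub_apply, Function.comp_apply]
        have q1 : 0 ≤ τ * η / 2 * ‖gradient (moreau γ (maxVal Y φ))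
          (iterate Y gx gy γ (τ * η) η z₀ (fun k => ξ k ω) t).x‖ ^ 2 := by positivity
        have q2 : 0 ≤ 3 / 8 * (τ * η) * ‖(1 / γ) •
            ((iterate Y gx gy γ (τ * η) η z₀ (fun k => ξ k ω) t).x
              - (iterate Y gx gy γ (τ * η) η z₀ (fun k => ξ k ω) (t + 1)).xφ)‖ ^ 2 := by positivity
        linarith
    exact (key.add (integrable_const (μ := P) Fstar)).congr (Eventually.of_forall fun ω => by simp)

theorem MinMaxProblem.integral_moreau_succ_le (h : MinMaxProblem Y φ gradY γ δ μ L M)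
    (ho : OracleAssumption D Y φ gradY gx gy M) (hξ : ∀ k, Measurable (ξ k))
    (hlaw : ∀ k, P.map (ξ k) = D) (hind : iIndepFun ξ P) (hy₀ : z₀.y ∈ Y)
    (hs : AdmissibleSteps γ δ μ L α τ η) {Fstar : ℝ}
    (hF : ∀ x, Fstar ≤ moreau γ (maxVal Y φ) x) (t : ℕ) :
    ∫ ω, moreau γ (maxVal Y φ) (iterate Y gx gy γ (τ * η) η z₀ (fun k => ξ k ω) (t + 1)).x ∂P
      ≤ ∫ ω, moreau γ (maxVal Y φ) (iterate Y gx gy γ (τ * η) η z₀ (fun k => ξ k ω) t).x ∂P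
        + τ * η / (2 * γ ^ 2) * ∫ ω, ‖(iterate Y gx gy γ (τ * η) η z₀ (fun k => ξ k ω) (t + 1)).xφ
            - prox γ (maxVal Y φ) (iterate Y gx gy γ (τ * η) η z₀ (fun k => ξ k ω) t).x‖ ^ 2 ∂P
        - τ * η / 2 * ∫ ω, ‖gradient (moreau γ (maxVal Y φ))
            (iterate Y gx gy γ (τ * η) η z₀ (fun k => ξ k ω) t).x‖ ^ 2 ∂P
        - 3 / 8 * (τ * η) * ∫ ω, ‖(1 / γ) •
            ((iterate Y gx gy γ (τ * η) η z₀ (fun k => ξ k ω) t).x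
              - (iterate Y gx gy γ (τ * η) η z₀ (fun k => ξ k ω) (t + 1)).xφ)‖ ^ 2 ∂P := by
  have hη₀ : 0 < τ * η := mul_pos hs.τ_pos hs.η_pos
  have hm := fun t => h.measurable_iterate (z₀ := z₀) ho hξ (τ * η) η t
  have hi := h.integrable_trackingError ho hξ hlaw hind hy₀ hs t
  have i0 := h.integrable_moreau ho hξ hlaw hind hy₀ hs hF t
  have i0' := h.integrable_moreau ho hξ hlaw hind hy₀ hs hF (t + 1)
  have i1 := (h.integrable_dist_prox_sq (measurable_x.comp (hm t)) (hm (t + 1)) hi).const_mul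
    (τ * η / (2 * γ ^ 2))
  have i2 := (h.integrable_gradient_sq (P := P) (measurable_x.comp (hm t))).const_mul (τ * η / 2)
  have i3 := (h.integrable_displacement_sq (measurable_x.comp (hm t)) (hm (t + 1)) hi).const_mul
    (3 / 8 * (τ * η))
  have key := integral_mono i0' (((i0.add i1).sub i2).sub i3) fun ω =>
    h.moreau_descent hη₀ hs.τη_le (iterate Y gx gy γ (τ * η) η z₀ (fun k => ξ k ω) t).x
          (iterate Y gx gy γ (τ * η) η z₀ (fun k => ξ k ω) (t + 1)).xφ
  rw [integral_sub' ((i0.add i1).sub i2) i3, integral_sub' (i0.add i1) i2, integral_add' i0 i1,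
    integral_const_mul, integral_const_mul, integral_const_mul] at key
  exact key

/-- The telescoped decrease of the potential. -/
theorem MinMaxProblem.sum_le (h : MinMaxProblem Y φ gradY γ δ μ L M)
    (ho : OracleAssumption D Y φ gradY gx gy M) (hξ : ∀ k, Measurable (ξ k))
    (hlaw : ∀ k, P.map (ξ k) = D) (hind : iIndepFun ξ P) (hy₀ : z₀.y ∈ Y)
    (hs : AdmissibleSteps γ δ μ L α τ η) {Fstar : ℝ}
    (hF : ∀ x, Fstar ≤ moreau γ (maxVal Y φ) x) (T : ℕ) :
    τ * η / 2 * ∑ t ∈ Finset.range T,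
        (3 / γ ^ 2 * ∫ ω, ‖(iterate Y gx gy γ (τ * η) η z₀ (fun k => ξ k ω) (t + 1)).xφ
            - prox γ (maxVal Y φ) (iterate Y gx gy γ (τ * η) η z₀ (fun k => ξ k ω) t).x‖ ^ 2 ∂P
          + ∫ ω, ‖gradient (moreau γ (maxVal Y φ))
            (iterate Y gx gy γ (τ * η) η z₀ (fun k => ξ k ω) t).x‖ ^ 2 ∂P)
      ≤ moreau γ (maxVal Y φ) z₀.x - Fstar
        + 2 * τ / (γ ^ 2 * α) * ∫ ω, trackingError Y φ γ z₀.x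
            (iterate Y gx gy γ (τ * η) η z₀ (fun k => ξ k ω) 1) ∂P
        + T * (18 * τ * η ^ 2 * M ^ 2 / (γ ^ 2 * α)) := by
  set A : ℕ → ℝ := fun t => ∫ ω, moreau γ (maxVal Y φ)
    (iterate Y gx gy γ (τ * η) η z₀ (fun k => ξ k ω) t).x ∂P with hA
  -- State t + 1 is measured against the saddle point for x_t, the centre used to produce it; hence
  -- the telescoped sum starts from x_φ^1 and y_1.
  set E : ℕ → ℝ := fun t => ∫ ω, trackingError Y φ γ
    (iterate Y gx gy γ (τ * η) η z₀ (fun k => ξ k ω) t).x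
    (iterate Y gx gy γ (τ * η) η z₀ (fun k => ξ k ω) (t + 1)) ∂P with hE
  set B : ℕ → ℝ := fun t => ∫ ω, ‖(iterate Y gx gy γ (τ * η) η z₀ (fun k => ξ k ω) (t + 1)).xφ
    - prox γ (maxVal Y φ) (iterate Y gx gy γ (τ * η) η z₀ (fun k => ξ k ω) t).x‖ ^ 2 ∂P with hB
  set N : ℕ → ℝ := fun t => ∫ ω, ‖gradient (moreau γ (maxVal Y φ))
    (iterate Y gx gy γ (τ * η) η z₀ (fun k => ξ k ω) t).x‖ ^ 2 ∂P with hN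
  set G : ℕ → ℝ := fun t => ∫ ω, ‖(1 / γ) •
    ((iterate Y gx gy γ (τ * η) η z₀ (fun k => ξ k ω) t).x
      - (iterate Y gx gy γ (τ * η) η z₀ (fun k => ξ k ω) (t + 1)).xφ)‖ ^ 2 ∂P with hG
  have hγ := h.γ_pos
  have hα := hs.α_pos
  have hτ := hs.τ_pos
  have hη := hs.η_pos
  have hm := fun t => h.measurable_iterate (z₀ := z₀) ho hξ (τ * η) η t
  have hi := h.integrable_trackingError ho hξ hlaw hind hy₀ hs
  have hBE : ∀ t, B t ≤ E t := fun t => by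
    refine integral_mono (h.integrable_dist_prox_sq (measurable_x.comp (hm t)) (hm (t + 1)) (hi t))
      (hi t) fun ω => ?_
    unfold trackingError
    exact le_add_of_nonneg_right (sq_nonneg _)
  have hG0 : ∀ t, 0 ≤ G t := fun t => integral_nonneg fun ω => by positivity
  have hE0 : ∀ t, 0 ≤ E t := fun t => integral_nonneg fun ω => trackingError_nonneg _ _
  have hAF : ∀ t, Fstar ≤ A t := fun t => by
    have := integral_mono (integrable_const Fstar)
      (h.integrable_moreau ho hξ hlaw hind hy₀ hs hF t) fun ω => hF _
    simpa using this
  have hA0 : A 0 = moreau γ (maxVal Y φ) z₀.x := by simp [hA, iterate]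
  -- With this weight the contraction contributes -(2τη/γ²)E, four times the error term of the
  -- descent, so three quarters of it survive as the 3/γ² in the sum. The drift costs only τη/16 of
  -- the available 3τη/8 in front of G.
  set C := 2 * τ / (γ ^ 2 * α) with hC
  have hC0 : 0 ≤ C := by positivity
  have hstep : ∀ t, A (t + 1) + C * E (t + 1) + τ * η / 2 * (3 / γ ^ 2 * B t + N t)
      ≤ A t + C * E t + 18 * τ * η ^ 2 * M ^ 2 / (γ ^ 2 * α) := by
    intro t
    have h1 : A (t + 1) ≤ A t + τ * η / (2 * γ ^ 2) * B t - τ * η / 2 * N t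
        - 3 / 8 * (τ * η) * G t := h.integral_moreau_succ_le ho hξ hlaw hind hy₀ hs hF t
    have h2 : E (t + 1) ≤ (1 - η * α) * E t + η * γ ^ 2 * α / 32 * G t + 9 * η ^ 2 * M ^ 2 :=
      (h.trackingError_succ ho hξ hlaw hind hy₀ hs t (hi t)).2
    have h3 := mul_le_mul_of_nonneg_left h2 hC0
    have e : C * ((1 - η * α) * E t + η * γ ^ 2 * α / 32 * G t + 9 * η ^ 2 * M ^ 2)
        = C * E t - 2 * (τ * η) / γ ^ 2 * E t + τ * η / 16 * G t
          + 18 * τ * η ^ 2 * M ^ 2 / (γ ^ 2 * α) := by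
      rw [hC]; field_simp; ring
    rw [e] at h3
    have h4 : 2 * (τ * η) / γ ^ 2 * B t ≤ 2 * (τ * η) / γ ^ 2 * E t :=
      mul_le_mul_of_nonneg_left (hBE t) (by positivity)
    have e2 : τ * η / (2 * γ ^ 2) * B t - 2 * (τ * η) / γ ^ 2 * B t
        = -(τ * η / 2 * (3 / γ ^ 2 * B t)) := by
      field_simp; ring
    have h5 : 0 ≤ τ * η * G t := mul_nonneg (by positivity) (hG0 t)
    linarith
  have hsum : ∀ T : ℕ, A T + C * E T + τ * η / 2 * ∑ t ∈ Finset.range T, (3 / γ ^ 2 * B t + N t)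
      ≤ A 0 + C * E 0 + T * (18 * τ * η ^ 2 * M ^ 2 / (γ ^ 2 * α)) := by
    intro T
    induction T with
    | zero => simp
    | succ T ih =>
      rw [Finset.sum_range_succ]
      push_cast
      linarith [hstep T]
  have h1 := hsum T
  have h2 : 0 ≤ C * E T := mul_nonneg hC0 (hE0 T)
  have h3 := hAF T
  rw [hA0] at h1
  have e : E 0 = ∫ ω, trackingError Y φ γ z₀.x
            (iterate Y gx gy γ (τ * η) η z₀ (fun k => ξ k ω) 1) ∂P := rfl
  rw [← e]
  linarith

end Trajectory

/-! ### Arithmetic of the step sizes and the iteration count -/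

namespace Constants

variable {c : Constants}

theorem rho_pos (hγ : 0 < c.γ) (hγδ : c.γ * c.δ < 1) : 0 < 1 / c.γ - c.δ := by
  rw [sub_pos, lt_div_iff₀ hγ]
  linarith

theorem α_pos (hγ : 0 < c.γ) (hγδ : c.γ * c.δ < 1) (hμ : 0 < c.μ) : 0 < c.α :=
  lt_min (half_pos (rho_pos hγ hγδ)) hμ

theorem τ_pos (hγ : 0 < c.γ) (hγδ : c.γ * c.δ < 1) (hμ : 0 < c.μ) (hL : 0 < c.L) : 0 < c.τ := by
  have := α_pos hγ hγδ hμ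
  exact lt_min (by positivity) (by positivity)

theorem ν_pos (hγ : 0 < c.γ) (hγδ : c.γ * c.δ < 1) (hμ : 0 < c.μ) (hL : 0 < c.L) : 0 < c.ν := by
  have := α_pos hγ hγδ hμ
  have := τ_pos hγ hγδ hμ hL
  exact lt_min one_pos (by positivity)

theorem γ_sub_pos (hγ : 0 < c.γ) (hγδ : c.γ * c.δ < 1) :
    0 < c.γ - c.γ ^ 2 * min c.δψ c.δ := by
  have h1 : c.γ ^ 2 * min c.δψ c.δ ≤ c.γ ^ 2 * c.δ := by gcongr; exact min_le_right _ _
  nlinarith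

theorem LF_pos (hγ : 0 < c.γ) (hγδ : c.γ * c.δ < 1) : 0 < c.LF :=
  div_pos two_pos (γ_sub_pos hγ hγδ)

theorem η₁_pos (hγ : 0 < c.γ) (hγδ : c.γ * c.δ < 1) (hμ : 0 < c.μ) (hL : 0 < c.L) (hM : 0 < c.M)
    {ε : ℝ} (hε : 0 < ε) : 0 < c.η₁ ε := by
  have hρ := rho_pos hγ hγδ
  have hα := α_pos hγ hγδ hμ
  have hτ := τ_pos hγ hγδ hμ hL
  have hν := ν_pos hγ hγδ hμ hL
  have hLF := LF_pos hγ hγδ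
  have hm : 0 < min 1 (c.γ ^ 2) := lt_min one_pos (by positivity)
  have hat : 0 < min c.α c.τ := lt_min hα hτ
  exact lt_min (lt_min (by positivity) (by positivity)) (by positivity)

theorem admissibleSteps (hγ : 0 < c.γ) (hδ : 0 ≤ c.δ) (hγδ : c.γ * c.δ < 1) (hδψ : 0 ≤ c.δψ)
    (hμ : 0 < c.μ) (hL : 0 < c.L) (hM : 0 < c.M) {ε : ℝ} (hε : 0 < ε) :
    AdmissibleSteps c.γ c.δ c.μ c.L c.α c.τ (c.η₁ ε) where
  α_pos := α_pos hγ hγδ hμ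
  α_le_rho := min_le_left _ _
  α_le_mu := min_le_right _ _
  τ_pos := τ_pos hγ hγδ hμ hL
  τ_le := by
    have : c.τ ≤ c.γ ^ 2 * c.α ^ 2 / 4 := min_le_left _ _
    linarith
  τL_le := by
    have hα := α_pos hγ hγδ hμ
    have hτ := τ_pos hγ hγδ hμ hL
    have h1 : c.τ ≤ c.μ ^ (3 / 2 : ℝ) * c.γ ^ 2 * c.α ^ (3 / 2 : ℝ) / (4 * c.L) := min_le_right _ _
    rw [le_div_iff₀ (by positivity)] at h1
    have h2 := pow_le_pow_left₀ (by positivity) h1 2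
    have cube : ∀ x : ℝ, 0 < x → (x ^ (3 / 2 : ℝ)) ^ 2 = x ^ 3 := fun x hx => by
      rw [← Real.rpow_mul_natCast hx.le, ← Real.rpow_natCast]
      norm_num
    rw [mul_pow (_ * _), mul_pow (c.μ ^ (3 / 2 : ℝ)), cube _ hμ, cube _ hα] at h2
    linarith
  η_pos := η₁_pos hγ hγδ hμ hL hM hε
  η_le := (min_le_left _ _).trans (min_le_left _ _)
  τη_le := by
    have hτ := τ_pos hγ hγδ hμ hL
    have hLF := LF_pos hγ hγδ
    have h1 : c.η₁ ε ≤ 1 / (2 * c.LF * c.τ) := (min_le_left _ _).trans (min_le_right _ _)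
    have h2 := mul_le_mul_of_nonneg_left h1 hτ.le
    have h3 := γ_sub_pos hγ hγδ
    -- This is the value of 1/(2L_F); it is at most γ/4 since min{δ_ψ, δ} ≥ 0.
    have h4 : c.τ * (1 / (2 * c.LF * c.τ)) = (c.γ - c.γ ^ 2 * min c.δψ c.δ) / 4 := by
      unfold LF
      field_simp
      ring
    have h5 : 0 ≤ c.γ ^ 2 * min c.δψ c.δ := mul_nonneg (sq_nonneg _) (le_min hδψ hδ)
    linarith

/-- The maximum lists the reciprocals of the three terms of the minimum η₁. Splitting on which term
is attained avoids any sign condition. -/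
theorem one_div_η₁_le (ε : ℝ) :
    1 / c.η₁ ε ≤ max (max (2 / (c.γ ^ 2 * (1 / c.γ - c.δ))) (2 * c.LF * c.τ))
      (384 * c.τ * c.M ^ 2 / (min 1 (c.γ ^ 2) * min c.α c.τ * c.ν * c.α * ε ^ 2)) := by
  have e : c.η₁ ε = c.γ ^ 2 * (1 / c.γ - c.δ) / 2 ∨ c.η₁ ε = 1 / (2 * c.LF * c.τ) ∨
      c.η₁ ε = min 1 (c.γ ^ 2) * min c.α c.τ * c.ν * c.α / (384 * c.τ * c.M ^ 2) * ε ^ 2 := by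
    unfold η₁
    rcases min_choice (min (c.γ ^ 2 * (1 / c.γ - c.δ) / 2) (1 / (2 * c.LF * c.τ)))
      (min 1 (c.γ ^ 2) * min c.α c.τ * c.ν * c.α / (384 * c.τ * c.M ^ 2) * ε ^ 2) with h | h
    · rw [h]
      rcases min_choice (c.γ ^ 2 * (1 / c.γ - c.δ) / 2) (1 / (2 * c.LF * c.τ)) with h' | h'
      · exact Or.inl h'
      · exact Or.inr (Or.inl h')
    · exact Or.inr (Or.inr h)
  rcases e with e | e | e
  · rw [e, one_div_div]
    exact (le_max_left _ _).trans (le_max_left _ _)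
  · rw [e, one_div_one_div]
    exact (le_max_right _ _).trans (le_max_left _ _)
  · rw [e, div_mul_eq_mul_div, one_div_div]
    exact le_max_right _ _

theorem min_one_inv_mul (hγ : 0 < c.γ) :
    min 1 (c.γ ^ 2)⁻¹ = min 1 (c.γ ^ 2) / c.γ ^ 2 := by
  have h2 : 0 < c.γ ^ 2 := by positivity
  rcases le_total 1 (c.γ ^ 2) with h | h
  · rw [min_eq_left h, min_eq_right (inv_le_one_of_one_le₀ h), one_div]
  · rw [min_eq_right h, min_eq_left ((one_le_inv₀ h2).2 h), div_self h2.ne']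

/-- The telescoped sum carries the factor min{1, 3/γ²}τ, while η₁ and T_ε are written with min{α,
τ}ν. The two terms of the minimum ν serve the two cases. -/
theorem min_mul_ν_le (hγ : 0 < c.γ) (hγδ : c.γ * c.δ < 1) (hμ : 0 < c.μ) (hL : 0 < c.L) :
    min c.α c.τ * c.ν ≤ min 1 (3 / c.γ ^ 2) * c.τ := by
  have hα := α_pos hγ hγδ hμ
  have hτ := τ_pos hγ hγδ hμ hL
  have hν := ν_pos hγ hγδ hμ hL
  rw [min_mul_of_nonneg _ _ hτ.le]
  refine le_min ?_ ?_
  · rw [mul_comm]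
    exact mul_le_mul (min_le_left _ _) (min_le_right _ _) (le_min hα.le hτ.le) zero_le_one
  · calc min c.α c.τ * c.ν ≤ c.α * (2 * c.τ / (c.γ ^ 2 * c.α)) :=
          mul_le_mul (min_le_left _ _) (min_le_right _ _) hν.le hα.le
      _ = 2 / c.γ ^ 2 * c.τ := by field_simp
      _ ≤ 3 / c.γ ^ 2 * c.τ := by gcongr; norm_num

/-- The arithmetic of the step sizes and of the iteration count. -/
theorem average_le (hγ : 0 < c.γ) (hγδ : c.γ * c.δ < 1) (hμ : 0 < c.μ) (hL : 0 < c.L)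
    (hM : 0 < c.M) {ε : ℝ} (hε : 0 < ε) {T : ℕ} (hT : 1 ≤ T) {Δ A B : ℝ} (hΔ : 0 ≤ Δ)
    (hA : 0 ≤ A) (hB : 0 ≤ B)
    (hle : 16 * Δ / (min 1 (c.γ ^ 2)⁻¹ * min c.α c.τ * c.ν * ε ^ 2) *
      max (max (2 / (c.γ ^ 2 * (1 / c.γ - c.δ))) (2 * c.LF * c.τ))
      (384 * c.τ * c.M ^ 2 / (min 1 (c.γ ^ 2) * min c.α c.τ * c.ν * c.α * ε ^ 2)) ≤ T)
    (hsum : c.τ * c.η₁ ε / 2 * (3 / c.γ ^ 2 * A + B)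
      ≤ Δ + T * (18 * c.τ * c.η₁ ε ^ 2 * c.M ^ 2 / (c.γ ^ 2 * c.α))) :
    1 / (T : ℝ) * (A + B) ≤ min 1 (c.γ ^ 2)⁻¹ * (ε ^ 2 / 4) := by
  have hα := α_pos hγ hγδ hμ
  have hτ := τ_pos hγ hγδ hμ hL
  have hν := ν_pos hγ hγδ hμ hL
  have hη := η₁_pos hγ hγδ hμ hL hM hε
  have hη3 : c.η₁ ε ≤ min 1 (c.γ ^ 2) * min c.α c.τ * c.ν * c.α / (384 * c.τ * c.M ^ 2) * ε ^ 2 :=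
    min_le_right _ _
  have hq := min_mul_ν_le hγ hγδ hμ hL
  have hmn := min_one_inv_mul hγ
  have hat : 0 < min c.α c.τ := lt_min hα hτ
  have hm : 0 < min 1 (c.γ ^ 2)⁻¹ := lt_min one_pos (by positivity)
  have hk : 0 < min 1 (3 / c.γ ^ 2) := lt_min one_pos (by positivity)
  have hT0 : (0 : ℝ) < T := by exact_mod_cast hT
  have hle' := (mul_le_mul_of_nonneg_left (one_div_η₁_le ε) (by positivity)).trans hle
  have hk1 : min 1 (3 / c.γ ^ 2) * (A + B) ≤ 3 / c.γ ^ 2 * A + B := by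
    have h1 := mul_le_mul_of_nonneg_right (min_le_right 1 (3 / c.γ ^ 2)) hA
    have h2 := mul_le_mul_of_nonneg_right (min_le_left 1 (3 / c.γ ^ 2)) hB
    linarith
  set m := min 1 (c.γ ^ 2)⁻¹
  set n := min 1 (c.γ ^ 2)
  set k := min 1 (3 / c.γ ^ 2)
  set η := c.η₁ ε
  set q := min c.α c.τ * c.ν with hqdef
  have hq0 : 0 < q := by positivity
  have h1 : Δ ≤ T * η * m * q * ε ^ 2 / 16 := by
    rw [mul_assoc m, ← hqdef, div_mul_div_comm, mul_one, div_le_iff₀ (by positivity)] at hle'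
    linarith
  have h2 : 18 * c.τ * η ^ 2 * c.M ^ 2 / (c.γ ^ 2 * c.α) ≤ 18 / 384 * (η * m * q * ε ^ 2) := by
    have e : 18 * c.τ * η ^ 2 * c.M ^ 2 / (c.γ ^ 2 * c.α)
        = 18 * c.τ * η * c.M ^ 2 / (c.γ ^ 2 * c.α) * η := by ring
    have e2 : 18 * c.τ * η * c.M ^ 2 / (c.γ ^ 2 * c.α)
        * (n * min c.α c.τ * c.ν * c.α / (384 * c.τ * c.M ^ 2) * ε ^ 2)
        = 18 / 384 * (η * m * q * ε ^ 2) := by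
      rw [hmn, hqdef]; field_simp
    rw [e, ← e2]
    gcongr
  -- The initial potential contributes 1/16 and the noise 18/384, in total 7/64, below the 1/8 that
  -- the conclusion requires.
  have h3 : c.τ * η / 2 * (k * (A + B)) ≤ T * (7 / 64 * (η * m * q * ε ^ 2)) := by
    have := mul_le_mul_of_nonneg_left hk1 (by positivity : 0 ≤ c.τ * η / 2)
    have := mul_le_mul_of_nonneg_left h2 hT0.le
    linarith
  have h4 : T * (7 / 64 * (η * m * q * ε ^ 2)) ≤ T * (1 / 8 * (η * m * (k * c.τ) * ε ^ 2)) := by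
    have p1 : T * (η * m * q * ε ^ 2) ≤ T * (η * m * (k * c.τ) * ε ^ 2) := by gcongr
    have p0 : 0 ≤ T * (η * m * q * ε ^ 2) := by positivity
    linarith
  rw [one_div_mul_eq_div, div_le_iff₀ hT0]
  have h5 : (c.τ * η / 2 * k) * (A + B - m * (ε ^ 2 / 4) * T) ≤ 0 := by linarith
  have := nonpos_of_mul_nonpos_right h5 (by positivity)
  linarith

end Constants

/-! ### A uniform random index independent of the samples -/

section RandomIndex

variable {Ω : Type*} [MeasurableSpace Ω] {P : Measure Ω} [IsProbabilityMeasure P]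

theorem ae_lt_of_uniform {T : ℕ} (hT : 1 ≤ T) {κ : Ω → ℕ} (hκ : Measurable κ)
    (hunif : ∀ k < T, P {ω | κ ω = k} = (T : ℝ≥0∞)⁻¹) : ∀ᵐ ω ∂P, κ ω < T := by
  have hms : ∀ k, MeasurableSet {ω | κ ω = k} := fun k => hκ (measurableSet_singleton k)
  have hset : {ω | κ ω < T} = ⋃ k ∈ Finset.range T, {ω | κ ω = k} := by
    ext ω; simp
  have h1 : P {ω | κ ω < T} = 1 := by
    rw [hset, measure_biUnion_finset ?_ fun k _ => hms k,
      Finset.sum_congr rfl fun k hk => hunif k (Finset.mem_range.1 hk), Finset.sum_const,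
      Finset.card_range, nsmul_eq_mul]
    · exact ENNReal.mul_inv_cancel (by exact_mod_cast (by omega : T ≠ 0)) (ENNReal.natCast_ne_top T)
    · intro i _ j _ hij
      exact Set.disjoint_left.2 fun ω hi hj => hij (hi.symm.trans hj)
  have hm : MeasurableSet {ω | κ ω < T} := hκ measurableSet_Iio
  exact (prob_compl_eq_zero_iff hm).2 h1

/-- The mean of a process at an independent uniform random time is the average of its means. -/
theorem integral_comp_uniform {A : Type*} [MeasurableSpace A] {T : ℕ} (hT : 1 ≤ T) {κ : Ω → ℕ}
    (hκ : Measurable κ) (hunif : ∀ k < T, P {ω | κ ω = k} = (T : ℝ≥0∞)⁻¹) {W : Ω → A}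
    (hind : IndepFun W κ P) {H : ℕ → A → ℝ} (hH : ∀ k, Measurable (H k))
    (hi : ∀ k < T, Integrable (fun ω => H k (W ω)) P) :
    Integrable (fun ω => H (κ ω) (W ω)) P ∧
      ∫ ω, H (κ ω) (W ω) ∂P = 1 / (T : ℝ) * ∑ k ∈ Finset.range T, ∫ ω, H k (W ω) ∂P := by
  -- The indicators of κ = k split the randomly indexed variable into a finite sum of products of
  -- independent factors.
  set I : ℕ → ℕ → ℝ := fun k j => if j = k then 1 else 0 with hI
  have hIm : ∀ k, Measurable (I k) := fun k => measurable_from_top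
  have hae : (fun ω => H (κ ω) (W ω)) =ᵐ[P]
      fun ω => ∑ k ∈ Finset.range T, H k (W ω) * I k (κ ω) := by
    filter_upwards [ae_lt_of_uniform hT hκ hunif] with ω hω
    simp [hI, hω]
  have hprod : ∀ k < T, Integrable (fun ω => H k (W ω) * I k (κ ω)) P ∧
      ∫ ω, H k (W ω) * I k (κ ω) ∂P = (∫ ω, H k (W ω) ∂P) * (1 / T) := by
    intro k hk
    have hind' : IndepFun (fun ω => H k (W ω)) (fun ω => I k (κ ω)) P := hind.comp (hH k) (hIm k)
    have hIi : Integrable (fun ω => I k (κ ω)) P := by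
      refine Integrable.of_bound ((hIm k).comp hκ).aestronglyMeasurable 1
        (Eventually.of_forall fun ω => ?_)
      simp only [hI]
      split_ifs <;> simp
    have hIint : ∫ ω, I k (κ ω) ∂P = 1 / T := by
      have hms : MeasurableSet {ω | κ ω = k} := hκ (measurableSet_singleton k)
      have e : (fun ω => I k (κ ω)) = Set.indicator {ω | κ ω = k} 1 := by
        funext ω
        simp [hI, Set.indicator_apply]
      rw [e, integral_indicator_one hms, measureReal_def, hunif k hk]
      simp
    refine ⟨hind'.integrable_mul (hi k hk) hIi, ?_⟩
    rw [← hIint]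
    exact hind'.integral_mul_eq_mul_integral (hi k hk).aestronglyMeasurable hIi.aestronglyMeasurable
  have hsi := integrable_finsetSum (Finset.range T) fun k hk =>
    (hprod k (Finset.mem_range.1 hk)).1
  refine ⟨hsi.congr hae.symm, ?_⟩
  rw [integral_congr_ae hae, integral_finsetSum _ fun k hk => (hprod k (Finset.mem_range.1 hk)).1,
    Finset.sum_congr rfl fun k hk => (hprod k (Finset.mem_range.1 hk)).2, ← Finset.sum_mul, mul_comm]

end RandomIndex

/-! ### Near stationarity and complexity -/

section Complexity

variable {dx dy : ℕ} {Y : Set (Vec dy)} {φ : Vec dx → Vec dy → ℝ}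
  {gradY : Vec dx → Vec dy → Vec dy} {c : Constants}
  {S : Type*} [MeasurableSpace S] {D : Measure S} [IsProbabilityMeasure D]
  {gx : Vec dx → Vec dy → S → Vec dx} {gy : Vec dx → Vec dy → S → Vec dy}
  {Ω : Type*} [MeasurableSpace Ω] {P : Measure Ω} [IsProbabilityMeasure P]
  {ξ : ℕ → Ω → S} {z₀ : State dx dy}

theorem MinMaxProblem.initPotential_eq (h : MinMaxProblem Y φ gradY c.γ c.δ c.μ c.L c.M)
    (ho : OracleAssumption D Y φ gradY gx gy c.M) (hξ : ∀ k, Measurable (ξ k))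
    (hlaw : ∀ k, P.map (ξ k) = D) (hind : iIndepFun ξ P) (hy₀ : z₀.y ∈ Y) {ε : ℝ}
    (hs : AdmissibleSteps c.γ c.δ c.μ c.L c.α c.τ (c.η₁ ε)) :
    initPotential P ξ c Y φ gx gy z₀ ε = 2 * c.τ / (c.γ ^ 2 * c.α) *
      ∫ ω, trackingError Y φ c.γ z₀.x
        (iterate Y gx gy c.γ (c.τ * c.η₁ ε) (c.η₁ ε) z₀ (fun k => ξ k ω) 1) ∂P := by
  have hi := (h.trackingError_zero (η₀ := c.τ * c.η₁ ε) ho hξ hlaw hind hy₀ hs.η_pos hs.η_le).1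
  have hm := h.measurable_iterate (z₀ := z₀) ho hξ (c.τ * c.η₁ ε) (c.η₁ ε) 1
  have i1 := h.integrable_dist_prox_sq (measurable_const (a := z₀.x)) hm hi
  have i2 := hi.sub i1
  have e : c.η₀ ε = c.τ * c.η₁ ε := rfl
  have hη := hs.η_pos
  have hα := hs.α_pos
  have hγ := h.γ_pos
  unfold initPotential run
  rw [e, ← integral_add i1 (i2.congr (Eventually.of_forall fun ω => by
    simp [trackingError]))]
  congr 1
  field_simp

theorem MinMaxProblem.average_bound (h : MinMaxProblem Y φ gradY c.γ c.δ c.μ c.L c.M)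
    (ho : OracleAssumption D Y φ gradY gx gy c.M) (hξ : ∀ k, Measurable (ξ k))
    (hlaw : ∀ k, P.map (ξ k) = D) (hind : iIndepFun ξ P) (hy₀ : z₀.y ∈ Y) {Fstar : ℝ}
    (hF : ∀ x, Fstar ≤ moreau c.γ (maxVal Y φ) x) (hL : 0 < c.L) (hM : 0 < c.M) {ε : ℝ}
    (hε : 0 < ε) (hs : AdmissibleSteps c.γ c.δ c.μ c.L c.α c.τ (c.η₁ ε)) {T : ℕ} (hT : 1 ≤ T)
    (hle : iterationBound P ξ c Y φ gx gy z₀ Fstar ε ≤ T) :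
    1 / (T : ℝ) * ∑ t ∈ Finset.range T,
        (∫ ω, ‖(run c Y gx gy z₀ ε (fun k => ξ k ω) (t + 1)).xφ
            - prox c.γ (maxVal Y φ) (run c Y gx gy z₀ ε (fun k => ξ k ω) t).x‖ ^ 2 ∂P +
         ∫ ω, ‖gradient (moreau c.γ (maxVal Y φ))
                (run c Y gx gy z₀ ε (fun k => ξ k ω) t).x‖ ^ 2 ∂P)
      ≤ min 1 (c.γ ^ 2)⁻¹ * (ε ^ 2 / 4) := by
  have hsum := h.sum_le ho hξ hlaw hind hy₀ hs hF T
  rw [← h.initPotential_eq ho hξ hlaw hind hy₀ hs, Finset.sum_add_distrib, ← Finset.mul_sum] at hsum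
  rw [Finset.sum_add_distrib]
  refine Constants.average_le h.γ_pos h.γδ_lt h.μ_pos hL hM hε hT ?_
    (Finset.sum_nonneg fun t _ => integral_nonneg fun ω => sq_nonneg _)
    (Finset.sum_nonneg fun t _ => integral_nonneg fun ω => sq_nonneg _) hle hsum
  have h1 := hF z₀.x
  have h2 : 0 ≤ initPotential P ξ c Y φ gx gy z₀ ε := by
    have hγ := h.γ_pos
    have hα := hs.α_pos
    have hτ := hs.τ_pos
    rw [h.initPotential_eq ho hξ hlaw hind hy₀ hs]
    exact mul_nonneg (by positivity) (integral_nonneg fun ω => trackingError_nonneg _ _)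
  linarith

/-- Take x' = prox_{γF}(X) and v = ∇F_γ(X), so that X - x' = γv. In min{1, γ⁻²} the term 1 bounds
𝔼‖v‖ and the term γ⁻² bounds γ𝔼‖v‖. -/
theorem MinMaxProblem.nearlyStationary_of_integral_le {γ δ μ L M : ℝ}
    (h : MinMaxProblem Y φ gradY γ δ μ L M) {X : Ω → Vec dx} (hX : Measurable X) {ε : ℝ}
    (hε : 0 < ε) (hle : ∫ ω, ‖gradient (moreau γ (maxVal Y φ)) (X ω)‖ ^ 2 ∂P
      ≤ min 1 (γ ^ 2)⁻¹ * (ε ^ 2 / 4)) :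
    NearlyStationary P (maxVal Y φ) ε X := by
  have hγ := h.γ_pos
  have hvm : Measurable fun ω => gradient (moreau γ (maxVal Y φ)) (X ω) :=
    h.continuous_gradient_moreau.measurable.comp hX
  have hvi : Integrable (fun ω => gradient (moreau γ (maxVal Y φ)) (X ω)) P :=
    Integrable.of_bound hvm.aestronglyMeasurable M
      (Eventually.of_forall fun ω => h.norm_gradient_moreau_le _)
  have hv2 := h.integrable_gradient_sq (P := P) hX
  have e : ∀ ω, X ω - prox γ (maxVal Y φ) (X ω) = γ • gradient (moreau γ (maxVal Y φ)) (X ω) := by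
    intro ω
    rw [h.gradient_moreau, smul_smul, mul_one_div_cancel hγ.ne', one_smul]
  refine ⟨fun ω => prox γ (maxVal Y φ) (X ω), fun ω => gradient (moreau γ (maxVal Y φ)) (X ω),
    Eventually.of_forall fun ω => h.gradient_moreau_mem_subdifferential _, hvi, ?_, ?_, ?_⟩
  · refine integral_norm_le_of_integral_sq_le hε hvi hv2 (hle.trans ?_)
    have := mul_le_mul_of_nonneg_right (min_le_left 1 (γ ^ 2)⁻¹) (by positivity : 0 ≤ ε ^ 2 / 4)
    linarith [sq_nonneg ε]
  · simp only [e]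
    exact hvi.smul γ
  · simp only [e, norm_smul, Real.norm_of_nonneg hγ.le]
    rw [integral_const_mul, ← le_div_iff₀' hγ]
    refine integral_norm_le_of_integral_sq_le (by positivity) hvi hv2 (hle.trans ?_)
    have := mul_le_mul_of_nonneg_right (min_le_right 1 (γ ^ 2)⁻¹) (by positivity : 0 ≤ ε ^ 2 / 4)
    refine this.trans ?_
    rw [div_pow, inv_mul_eq_div]
    gcongr
    linarith [sq_nonneg ε]

omit [IsProbabilityMeasure D] in
theorem MinMaxProblem.nearlyStationary_uniform (h : MinMaxProblem Y φ gradY c.γ c.δ c.μ c.L c.M)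
    (ho : OracleAssumption D Y φ gradY gx gy c.M) (hξ : ∀ k, Measurable (ξ k)) {ε : ℝ}
    (hε : 0 < ε) {T : ℕ} (hT : 1 ≤ T)
    (hle : 1 / (T : ℝ) * ∑ t ∈ Finset.range T,
        (∫ ω, ‖(run c Y gx gy z₀ ε (fun k => ξ k ω) (t + 1)).xφ
            - prox c.γ (maxVal Y φ) (run c Y gx gy z₀ ε (fun k => ξ k ω) t).x‖ ^ 2 ∂P +
         ∫ ω, ‖gradient (moreau c.γ (maxVal Y φ))
                (run c Y gx gy z₀ ε (fun k => ξ k ω) t).x‖ ^ 2 ∂P)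
      ≤ min 1 (c.γ ^ 2)⁻¹ * (ε ^ 2 / 4)) {κ : Ω → ℕ} (hκ : Measurable κ)
    (hind : IndepFun (fun ω k => ξ k ω) κ P) (hunif : ∀ k < T, P {ω | κ ω = k} = (T : ℝ≥0∞)⁻¹) :
    NearlyStationary P (maxVal Y φ) ε
      (fun ω => (run c Y gx gy z₀ ε (fun k => ξ k ω) (κ ω)).x) := by
  have hXm : ∀ k, Measurable fun s : ℕ → S => (run c Y gx gy z₀ ε s k).x := fun k =>
    measurable_x.comp (SMAG.measurable_iterate h.closed h.convex h.nonempty ho.measurable_gx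
      ho.measurable_gy _ _ _ z₀ (fun k (s : ℕ → S) => s k) k fun k _ => measurable_pi_apply k)
  have hHm : ∀ k, Measurable fun s : ℕ → S =>
      ‖gradient (moreau c.γ (maxVal Y φ)) (run c Y gx gy z₀ ε s k).x‖ ^ 2 := fun k =>
    (h.continuous_gradient_moreau.norm.pow 2).measurable.comp (hXm k)
  have hξm : Measurable fun ω k => ξ k ω := measurable_pi_lambda _ hξ
  have hXκ : Measurable fun ω => (run c Y gx gy z₀ ε (fun k => ξ k ω) (κ ω)).x := by
    -- The index set is countable, so measurability at each fixed index gives joint measurability.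
    have : Measurable fun q : (ℕ → S) × ℕ => (run c Y gx gy z₀ ε q.1 q.2).x :=
      measurable_from_prod_countable_left hXm
    exact this.comp (hξm.prodMk hκ)
  have hmean := (integral_comp_uniform hT hκ hunif hind hHm fun k _ =>
    h.integrable_gradient_sq ((hXm k).comp hξm)).2
  refine h.nearlyStationary_of_integral_le hXκ hε (hmean.trans_le (le_trans ?_ hle))
  gcongr with t _
  exact le_add_of_nonneg_left (integral_nonneg fun ω => sq_nonneg _)

theorem MinMaxProblem.exists_iterationBound_le (h : MinMaxProblem Y φ gradY c.γ c.δ c.μ c.L c.M)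
    (ho : OracleAssumption D Y φ gradY gx gy c.M) (hξ : ∀ k, Measurable (ξ k))
    (hlaw : ∀ k, P.map (ξ k) = D) (hind : iIndepFun ξ P) (hy₀ : z₀.y ∈ Y) {Fstar : ℝ}
    (hF : ∀ x, Fstar ≤ moreau c.γ (maxVal Y φ) x) (hL : 0 < c.L) (hM : 0 < c.M)
    (hs : ∀ ε, 0 < ε → AdmissibleSteps c.γ c.δ c.μ c.L c.α c.τ (c.η₁ ε)) :
    ∃ C : ℝ, 0 < C ∧ ∀ ε : ℝ, 0 < ε → ε ≤ 1 →
      c.η₁ ε ≤ C * ε ^ 2 ∧ iterationBound P ξ c Y φ gx gy z₀ Fstar ε ≤ C / ε ^ 4 := by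
  have hγ := h.γ_pos
  have hρ := h.rho_pos
  have hα := Constants.α_pos hγ h.γδ_lt h.μ_pos
  have hτ := Constants.τ_pos hγ h.γδ_lt h.μ_pos hL
  have hν := Constants.ν_pos hγ h.γδ_lt h.μ_pos hL
  have hLF := Constants.LF_pos hγ h.γδ_lt
  have hm : 0 < min 1 (c.γ ^ 2)⁻¹ := lt_min one_pos (by positivity)
  have hn : 0 < min 1 (c.γ ^ 2) := lt_min one_pos (by positivity)
  have hat : 0 < min c.α c.τ := lt_min hα hτ
  set C₁ := min 1 (c.γ ^ 2) * min c.α c.τ * c.ν * c.α / (384 * c.τ * c.M ^ 2) with hC₁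
  set K := max (2 / (c.γ ^ 2 * (1 / c.γ - c.δ))) (2 * c.LF * c.τ) with hK
  set Q := 384 * c.τ * c.M ^ 2 / (min 1 (c.γ ^ 2) * min c.α c.τ * c.ν * c.α) with hQ
  -- P₀ depends on ε through η₁. Replacing η₁ by its ε-free cap γ²(1/γ - δ)/2 in the first-step
  -- bound makes the estimate uniform in ε.
  set E := trackingError Y φ c.γ z₀.x z₀
    + 9 * (c.γ ^ 2 * (1 / c.γ - c.δ) / 2) ^ 2 * c.M ^ 2 with hE
  set Δ := moreau c.γ (maxVal Y φ) z₀.x - Fstar + 2 * c.τ / (c.γ ^ 2 * c.α) * E with hΔ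
  have hE0 : 0 ≤ E := add_nonneg (trackingError_nonneg _ _) (by positivity)
  have hΔ0 : 0 ≤ Δ := add_nonneg (by linarith [hF z₀.x]) (by positivity)
  have hC₁0 : 0 < C₁ := by positivity
  have hK0 : 0 < K := lt_max_of_lt_right (by positivity)
  have hQ0 : 0 < Q := by positivity
  set R := 16 * Δ / (min 1 (c.γ ^ 2)⁻¹ * min c.α c.τ * c.ν) * max K Q with hR
  have hKQ : 0 < max K Q := lt_max_of_lt_left hK0
  have hR0 : 0 ≤ R := by positivity
  refine ⟨C₁ + R, by positivity, fun ε hε hε1 => ⟨?_, ?_⟩⟩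
  · have : c.η₁ ε ≤ C₁ * ε ^ 2 := min_le_right _ _
    have : 0 ≤ R * ε ^ 2 := by positivity
    linarith
  · have hP : initPotential P ξ c Y φ gx gy z₀ ε ≤ 2 * c.τ / (c.γ ^ 2 * c.α) * E := by
      rw [h.initPotential_eq ho hξ hlaw hind hy₀ (hs ε hε)]
      have h1 := (h.trackingError_zero (η₀ := c.τ * c.η₁ ε) ho hξ hlaw hind hy₀ (hs ε hε).η_pos
        (hs ε hε).η_le).2
      have h2 := pow_le_pow_left₀ (hs ε hε).η_pos.le (hs ε hε).η_le 2
      have h3 : 9 * c.η₁ ε ^ 2 * c.M ^ 2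
        ≤ 9 * (c.γ ^ 2 * (1 / c.γ - c.δ) / 2) ^ 2 * c.M ^ 2 := by gcongr
      exact mul_le_mul_of_nonneg_left (by linarith) (by positivity)
    have hε2 : ε ^ 2 ≤ 1 := pow_le_one₀ hε.le hε1
    have hmax : max K (384 * c.τ * c.M ^ 2 /
        (min 1 (c.γ ^ 2) * min c.α c.τ * c.ν * c.α * ε ^ 2)) ≤ max K Q / ε ^ 2 := by
      refine max_le ?_ ?_
      · rw [le_div_iff₀ (by positivity)]
        exact (mul_le_of_le_one_right hK0.le hε2).trans (le_max_left _ _)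
      · rw [← div_div, ← hQ]
        gcongr
        exact le_max_right _ _
    have hb : iterationBound P ξ c Y φ gx gy z₀ Fstar ε
        ≤ 16 * Δ / (min 1 (c.γ ^ 2)⁻¹ * min c.α c.τ * c.ν * ε ^ 2) * (max K Q / ε ^ 2) := by
      unfold iterationBound
      refine mul_le_mul ?_ hmax (le_max_of_le_left hK0.le) (by positivity)
      gcongr
      linarith
    refine hb.trans (le_trans (le_of_eq (b := R / ε ^ 4) ?_) ?_)
    · rw [hR]; field_simp
    · gcongr
      linarith

end Complexity

end SMAG

theorem corollary2 {dx dy : ℕ}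
    (Y : Set (SMAG.Vec dy)) (hY_closed : IsClosed Y) (hY_convex : Convex ℝ Y)
    (φ : SMAG.Vec dx → SMAG.Vec dy → ℝ) (gradY : SMAG.Vec dx → SMAG.Vec dy → SMAG.Vec dy)
    (c : SMAG.Constants) (Fstar : ℝ)
    (hγ : 0 < c.γ) (hδ : 0 ≤ c.δ) (hγδ : c.γ * c.δ < 1) (hδψ : 0 ≤ c.δψ)
    (hμ : 0 < c.μ) (hL : 0 < c.L) (hM : 0 < c.M)
    (hprob : SMAG.ProblemAssumption Y φ gradY c.γ c.δ c.μ c.L Fstar)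
    {S : Type*} [MeasurableSpace S] (D : Measure S) [IsProbabilityMeasure D]
    (gx : SMAG.Vec dx → SMAG.Vec dy → S → SMAG.Vec dx)
    (gy : SMAG.Vec dx → SMAG.Vec dy → S → SMAG.Vec dy)
    (horacle : SMAG.OracleAssumption D Y φ gradY gx gy c.M)
    {Ω : Type*} [MeasurableSpace Ω] (P : Measure Ω) [IsProbabilityMeasure P]
    (ξ : ℕ → Ω → S) (hξ_meas : ∀ t, Measurable (ξ t)) (hξ_law : ∀ t, P.map (ξ t) = D)
    (hξ_indep : iIndepFun ξ P)
    (z₀ : SMAG.State dx dy) (hy₀ : z₀.y ∈ Y) :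
    Differentiable ℝ (SMAG.moreau c.γ (SMAG.maxVal Y φ)) ∧
    (∀ ε : ℝ, 0 < ε → ∀ T : ℕ, 1 ≤ T →
      SMAG.iterationBound P ξ c Y φ gx gy z₀ Fstar ε ≤ T →
      (∀ t < T,
        Integrable (fun ω => ‖(SMAG.run c Y gx gy z₀ ε (fun k => ξ k ω) (t + 1)).xφ
          - SMAG.prox c.γ (SMAG.maxVal Y φ)
              (SMAG.run c Y gx gy z₀ ε (fun k => ξ k ω) t).x‖ ^ 2) P ∧
        Integrable (fun ω => ‖gradient (SMAG.moreau c.γ (SMAG.maxVal Y φ))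
              (SMAG.run c Y gx gy z₀ ε (fun k => ξ k ω) t).x‖ ^ 2) P) ∧
      1 / (T : ℝ) * ∑ t ∈ Finset.range T,
        (∫ ω, ‖(SMAG.run c Y gx gy z₀ ε (fun k => ξ k ω) (t + 1)).xφ
            - SMAG.prox c.γ (SMAG.maxVal Y φ)
                (SMAG.run c Y gx gy z₀ ε (fun k => ξ k ω) t).x‖ ^ 2 ∂P +
         ∫ ω, ‖gradient (SMAG.moreau c.γ (SMAG.maxVal Y φ))
                (SMAG.run c Y gx gy z₀ ε (fun k => ξ k ω) t).x‖ ^ 2 ∂P)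
        ≤ min 1 (c.γ ^ 2)⁻¹ * (ε ^ 2 / 4) ∧
      (∀ tbar : Ω → ℕ, Measurable tbar →
        IndepFun (fun ω k => ξ k ω) tbar P →
        (∀ k < T, P {ω | tbar ω = k} = (T : ℝ≥0∞)⁻¹) →
        SMAG.NearlyStationary P (SMAG.maxVal Y φ) ε
          (fun ω => (SMAG.run c Y gx gy z₀ ε (fun k => ξ k ω) (tbar ω)).x))) ∧
    (∃ C : ℝ, 0 < C ∧ ∀ ε : ℝ, 0 < ε → ε ≤ 1 →
      c.η₁ ε ≤ C * ε ^ 2 ∧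
      SMAG.iterationBound P ξ c Y φ gx gy z₀ Fstar ε ≤ C / ε ^ 4) := by
  have h := hprob.minMaxProblem horacle hY_closed hY_convex ⟨_, hy₀⟩ hγ hδ hγδ hμ hM
  have hs : ∀ ε : ℝ, 0 < ε → SMAG.AdmissibleSteps c.γ c.δ c.μ c.L c.α c.τ (c.η₁ ε) :=
    fun ε hε => SMAG.Constants.admissibleSteps hγ hδ hγδ hδψ hμ hL hM hε
  refine ⟨fun x => (h.hasGradientAt_moreau x).differentiableAt, fun ε hε T hT hle => ?_,
    h.exists_iterationBound_le horacle hξ_meas hξ_law hξ_indep hy₀ hprob.bddBelow hL hM hs⟩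
  have havg := h.average_bound horacle hξ_meas hξ_law hξ_indep hy₀ hprob.bddBelow hL hM hε
    (hs ε hε) hT hle
  have hm := fun t => h.measurable_iterate (z₀ := z₀) horacle hξ_meas (c.τ * c.η₁ ε) (c.η₁ ε) t
  refine ⟨fun t _ => ⟨?_, ?_⟩, havg, fun κ hκ hind hunif =>
    h.nearlyStationary_uniform horacle hξ_meas hε hT havg hκ hind hunif⟩
  · exact h.integrable_dist_prox_sq (SMAG.measurable_x.comp (hm t)) (hm (t + 1))
      (h.integrable_trackingError horacle hξ_meas hξ_law hξ_indep hy₀ (hs ε hε) t)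
  · exact h.integrable_gradient_sq (SMAG.measurable_x.comp (hm t))
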